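/- Let $\psi\in\mathbb C^2\otimes\mathbb C^2$ be a unit vector (a 2-qubit pure state). Its Bloch components are the real numbers $\operatorname{tr}\big((\sigma_i\otimes\sigma_j)|\psi\rangle\langle\psi|\big)$, $0\le i,j\le 3$, where $\sigma_0=I$ and $\sigma_1,\sigma_2,\sigma_3$ are the Pauli matrices. They are listed as $b_1=1$ (for $I\otimes I$), $(b_2,b_3,b_4)=\alpha$ (for $\sigma_i\otimes I$), $(b_5,b_6,b_7)=\beta$ (for $I\otimes\sigma_j$), and $b_8,\dots,b_{16}$, the entries of the $3\times3$ correlation matrix $C=(c_{ij})$ (for $\sigma_i\otimes\sigma_j$) in row-major order. For $2\le k\le 16$ let $b_k^{\max}$ and $b_k^{\min}$ be the largest and the smallest value that the $k$-th Bloch component takes on the pure states whose first $k-1$ components are $b_1,\dots,b_{k-1}$. Put $h_k=(b_k^{\max}+b_k^{\min})/2$ and $$D(b,h)=\frac{\left(\frac{1+b}{2}\right)^2}{\frac{1+h}{2}}+\frac{\left(\frac{1-b}{2}\right)^2}{\frac{1-h}{2}}-1$$ (with $0/0=0$). The posterior $\chi^2$-divergence information content of $\psi$ is $I(\psi)=\sum_{k=2}^{16}D(b_k,h_k)$.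 Let $\mu=\|\alpha\|$. Theorem. The maximum of $I(\psi)$ over all 2-qubit pure states exists and equals $2$; in particular $\sup_\psi I(\psi)=2$. More precisely, for every 2-qubit pure state $\psi$ one has $0\le\mu\le1$, and: 1. $\mu=1$ if and only if $\psi$ is a product state, and then $I(\psi)=2$. 2. $\mu=0$ if and only if $\psi$ is maximally entangled (the reduced state of the first qubit is $I/2$), and then $I(\psi)\le2$, with equality if and only if $|c_{ij}|=1$ for some $i\in\{1,2\}$ and $j\in\{1,2,3\}$. In particular $I(\psi)=2$ for each of the four Bell states $\frac{1}{\sqrt2}\big(|0,x\rangle+(-1)^z|1,1-x\rangle\big)$, $x,z\in\{0,1\}$. 3. If $0<\mu<1$, then $I(\psi)<2$. -/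

import Mathlib

open scoped Kronecker Matrix

noncomputable section

/-- Vectors of `ℂ² ⊗ ℂ²`, in the computational basis `|ij⟩`. -/
abbrev TwoQubit : Type := EuclideanSpace ℂ (Fin 2 × Fin 2)

/-- A pure state vector: a unit vector. -/
def IsPureState (ψ : TwoQubit) : Prop := ‖ψ‖ = 1

/-- The identity and the three Pauli matrices `σ₁, σ₂, σ₃`. -/
def pauli : Fin 4 → Matrix (Fin 2) (Fin 2) ℂ :=
  ![1, !![0, 1; 1, 0], !![0, -Complex.I; Complex.I, 0], !![1, 0; 0, -1]]

/-- The density matrix `|ψ⟩⟨ψ|`. -/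
def density (ψ : TwoQubit) : Matrix (Fin 2 × Fin 2) (Fin 2 × Fin 2) ℂ :=
  Matrix.vecMulVec ψ (star ψ)

/-- `tr ((σᵢ ⊗ σⱼ) |ψ⟩⟨ψ|)`, which is a real number. -/
def pauliExp (ψ : TwoQubit) (i j : Fin 4) : ℝ :=
  (((pauli i) ⊗ₖ (pauli j)) * density ψ).trace.re

/-- The order of the Bloch components: the dummy component, `α₁ α₂ α₃`, `β₁ β₂ β₃`, and the
correlation matrix in row-major order. -/
def blochIndex : Fin 16 → Fin 4 × Fin 4 :=
  ![(0, 0), (1, 0), (2, 0), (3, 0), (0, 1), (0, 2), (0, 3),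
    (1, 1), (1, 2), (1, 3), (2, 1), (2, 2), (2, 3), (3, 1), (3, 2), (3, 3)]

/-- The Bloch vector; position `k` (counted from zero) holds the component `b_{k+1}`. -/
def bloch (ψ : TwoQubit) (k : Fin 16) : ℝ :=
  pauliExp ψ (blochIndex k).1 (blochIndex k).2

/-- The values that component `k` can take on pure states which agree with `ψ` in all the
earlier components. -/
def feasible (ψ : TwoQubit) (k : Fin 16) : Set ℝ :=
  {x | ∃ φ : TwoQubit, IsPureState φ ∧ (∀ j < k, bloch φ j = bloch ψ j) ∧ bloch φ k = x}

/-- The largest feasible value of component `k`. -/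
def blochMax (ψ : TwoQubit) (k : Fin 16) : ℝ := sSup (feasible ψ k)

/-- The smallest feasible value of component `k`. -/
def blochMin (ψ : TwoQubit) (k : Fin 16) : ℝ := sInf (feasible ψ k)

/-- The χ²-divergence of the two-point distribution `((1+b)/2, (1-b)/2)` from
`((1+h)/2, (1-h)/2)`; a term `0/0` counts as `0`. -/
def chiSq (b h : ℝ) : ℝ :=
  ((b + 1) / 2) ^ 2 / ((h + 1) / 2) + ((1 - b) / 2) ^ 2 / ((1 - h) / 2) - 1

/-- The posterior χ²-divergence information content: the sum over `b₂, …, b₁₆`. -/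
def postInfo (ψ : TwoQubit) : ℝ :=
  ∑ k : Fin 15, chiSq (bloch ψ k.succ) ((blochMax ψ k.succ + blochMin ψ k.succ) / 2)

/-- The length `μ` of the local Bloch vector `α`. -/
def localNorm (ψ : TwoQubit) : ℝ :=
  √(pauliExp ψ 1 0 ^ 2 + pauliExp ψ 2 0 ^ 2 + pauliExp ψ 3 0 ^ 2)

/-- `ψ` is a tensor product of two vectors of `ℂ²`. -/
def IsProductState (ψ : TwoQubit) : Prop :=
  ∃ u v : Fin 2 → ℂ, ∀ i j, ψ (i, j) = u i * v j

/-- The reduced state of the first qubit is `I/2`. -/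
def IsMaxEntangled (ψ : TwoQubit) : Prop :=
  ∀ i i' : Fin 2, ∑ j, ψ (i, j) * star (ψ (i', j)) = if i = i' then 1 / 2 else 0

/-- The Bell states `(|0,x⟩ + (-1)^z |1,1-x⟩)/√2`. -/
def bellState (x z : Fin 2) : TwoQubit :=
  WithLp.toLp 2 fun p =>
    if p.2 = p.1 + x then (-1 : ℂ) ^ ((z : ℕ) * (p.1 : ℕ)) / ((√2 : ℝ) : ℂ) else 0

theorem continuous_bloch (k : Fin 16) : Continuous fun ψ : TwoQubit => bloch ψ k := by
  unfold bloch pauliExp density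
  refine Complex.continuous_re.comp (Continuous.matrix_trace ?_)
  refine continuous_const.matrix_mul (Continuous.matrix_vecMulVec ?_ ?_) <;> fun_prop

theorem isCompact_feasible (ψ : TwoQubit) (k : Fin 16) : IsCompact (feasible ψ k) := by
  have hc : IsCompact (Metric.sphere (0 : TwoQubit) 1 ∩
      {φ | ∀ j < k, bloch φ j = bloch ψ j}) := by
    refine (isCompact_sphere 0 1).inter_right ?_
    simp only [Set.ofPred_forall]
    exact isClosed_iInter fun j => isClosed_iInter fun _ =>
      isClosed_eq (continuous_bloch j) continuous_const
  convert hc.image (continuous_bloch k) using 1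
  ext x
  simp [feasible, IsPureState, and_assoc]

/-- The extreme values are attained. -/
theorem isGreatest_blochMax {ψ : TwoQubit} (hψ : IsPureState ψ) (k : Fin 16) :
    IsGreatest (feasible ψ k) (blochMax ψ k) :=
  (isCompact_feasible ψ k).isGreatest_sSup ⟨bloch ψ k, ψ, hψ, fun _ _ => rfl, rfl⟩

theorem isLeast_blochMin {ψ : TwoQubit} (hψ : IsPureState ψ) (k : Fin 16) :
    IsLeast (feasible ψ k) (blochMin ψ k) :=
  (isCompact_feasible ψ k).isLeast_sInf ⟨bloch ψ k, ψ, hψ, fun _ _ => rfl, rfl⟩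

end

/-! A local unitary acts on the Bloch data by rotations: α ↦ Rα and C ↦ RC on the first qubit, β ↦
Rβ and C ↦ CRᵀ on the second. A suitable half-turn keeps the earlier entries of α (or β) and negates
the next one, so the six local components have midpoint 0 and contribute ‖α‖² + ‖β‖² = 2μ²
(`postInfo_eq`). The nine correlation entries therefore have to contribute at most 2(1 - μ²).
Midpoints come from symmetry of the feasible sets (`blochMid_eq_of_symm`), without computing the
extremes.

If μ = 1, then C = αβᵀ is forced and contributes nothing.

If 0 < μ < 1, the states with given α, β form a circle of squared radius S = 1 - μ²
(`exists_circle`), and each entry of C is an affine function m + pG + qH on it, with G² + H² ≤ (1 -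
|m|)². The first entry not constant on the circle cuts it down to at most two points, mirror images
of each other; one later entry may separate these, and everything else is determined. So at most two
entries contribute (`not_three_split`), each at most S (`chiSq_le_of_sq_le`). The first reaches S
only at an extreme of its range; there the two points coincide and no second entry contributes
(`sq_circleVal_sub_lt`). Hence the sum is strictly below 2S.

If μ = 0, then C is orthogonal and its first two rows may be reflected simultaneously
(`exists_reflected`). This gives the midpoints explicitly; the first row contributes 1, the last row
0, and the second row is handled by a rational inequality whose defect is a sum of two nonnegative
products (`maxEntangled_ineq`). Their vanishing yields the equality cases. -/

noncomputable section

/-! ### Pauli expectations as polynomials in real coordinates -/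

/-- The Pauli expectations of the vector with coordinates `xₖ + i yₖ`. -/
def coordExp (x y : Fin 4 → ℝ) : Matrix (Fin 4) (Fin 4) ℝ :=
  let r (p q : Fin 4) := x p * x q + y p * y q
  let s (p q : Fin 4) := x p * y q - y p * x q
  !![r 0 0 + r 1 1 + r 2 2 + r 3 3, 2 * (r 0 1 + r 2 3), 2 * (s 0 1 + s 2 3),
      r 0 0 - r 1 1 + r 2 2 - r 3 3;
    2 * (r 0 2 + r 1 3), 2 * (r 0 3 + r 1 2), 2 * (s 0 3 + s 2 1), 2 * (r 0 2 - r 1 3);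
    2 * (s 0 2 + s 1 3), 2 * (s 0 3 + s 1 2), 2 * (r 1 2 - r 0 3), 2 * (s 0 2 - s 1 3);
    r 0 0 + r 1 1 - r 2 2 - r 3 3, 2 * (r 0 1 - r 2 3), 2 * (s 0 1 - s 2 3),
      r 0 0 - r 1 1 - r 2 2 + r 3 3]

def reCoord (ψ : TwoQubit) : Fin 4 → ℝ :=
  ![(ψ (0, 0)).re, (ψ (0, 1)).re, (ψ (1, 0)).re, (ψ (1, 1)).re]

def imCoord (ψ : TwoQubit) : Fin 4 → ℝ :=
  ![(ψ (0, 0)).im, (ψ (0, 1)).im, (ψ (1, 0)).im, (ψ (1, 1)).im]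

theorem pauliExp_eq_sum (ψ : TwoQubit) (a b : Fin 4) : pauliExp ψ a b =
    (∑ i, ∑ j, ∑ k, ∑ l, pauli a i k * pauli b j l * (ψ (k, l) * star (ψ (i, j)))).re := by
  simp [pauliExp, density, Matrix.trace, Matrix.mul_apply, Fintype.sum_prod_type,
    Matrix.vecMulVec_apply, Matrix.kroneckerMap_apply]

/-- Turns every later identity between Bloch components into a polynomial identity in eight real
variables, within reach of `ring`. -/
theorem pauliExp_eq_coordExp (ψ : TwoQubit) (a b : Fin 4) :
    pauliExp ψ a b = coordExp (reCoord ψ) (imCoord ψ) a b := by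
  fin_cases a <;> fin_cases b <;>
    simp [pauliExp_eq_sum, pauli, coordExp, reCoord, imCoord] <;> ring

theorem isPureState_iff (ψ : TwoQubit) : IsPureState ψ ↔ pauliExp ψ 0 0 = 1 := by
  rw [IsPureState, ← sq_eq_sq₀ (norm_nonneg _) zero_le_one, EuclideanSpace.norm_sq_eq]
  simp [pauliExp_eq_coordExp, coordExp, reCoord, imCoord, Fintype.sum_prod_type,
    Complex.sq_norm, Complex.normSq_apply, add_assoc]

/-- The correlation matrix. -/
def corr (ψ : TwoQubit) : Matrix (Fin 3) (Fin 3) ℝ := fun i j => pauliExp ψ i.succ j.succ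

/-- The Bloch vector of the first qubit. -/
def blochA (ψ : TwoQubit) : Fin 3 → ℝ := fun i => pauliExp ψ i.succ 0

/-- The Bloch vector of the second qubit. -/
def blochB (ψ : TwoQubit) : Fin 3 → ℝ := fun j => pauliExp ψ 0 j.succ

/-- The matrix of `v ↦ a × v`. -/
def crossMat (a : Fin 3 → ℝ) : Matrix (Fin 3) (Fin 3) ℝ :=
  !![0, -a 2, a 1; a 2, 0, -a 0; -a 1, a 0, 0]

/-- The rotation given by the quaternion with real part `x` and imaginary part `n`. -/
def quatRot (x : ℝ) (n : Fin 3 → ℝ) : Matrix (Fin 3) (Fin 3) ℝ :=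
  (x ^ 2 - n ⬝ᵥ n) • 1 + (2 : ℝ) • Matrix.vecMulVec n n + (2 * x) • crossMat n

/-- The matrix `x - i n·σ`. -/
def quatMat (x : ℝ) (n : Fin 3 → ℝ) : Matrix (Fin 2) (Fin 2) ℂ :=
  !![x - Complex.I * n 2, -Complex.I * n 0 - n 1; -Complex.I * n 0 + n 1, x + Complex.I * n 2]

def actA (x : ℝ) (n : Fin 3 → ℝ) (ψ : TwoQubit) : TwoQubit :=
  WithLp.toLp 2 fun p => ∑ i, quatMat x n p.1 i * ψ (i, p.2)

def actB (x : ℝ) (n : Fin 3 → ℝ) (ψ : TwoQubit) : TwoQubit :=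
  WithLp.toLp 2 fun p => ∑ j, quatMat x n p.2 j * ψ (p.1, j)

/-! ### Homogeneous identities between α, β and C, valid without normalization -/

section relations

theorem corr_mulVec_blochB_hom (ψ : TwoQubit) :
    corr ψ *ᵥ blochB ψ = pauliExp ψ 0 0 • blochA ψ := by
  ext i
  simp only [Matrix.mulVec, dotProduct, Fin.sum_univ_three, Pi.smul_apply, smul_eq_mul, corr,
    blochA, blochB, pauliExp_eq_coordExp]
  generalize reCoord ψ = x
  generalize imCoord ψ = y
  fin_cases i <;> simp [coordExp] <;> ring

theorem corr_mul_transpose_hom (ψ : TwoQubit) :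
    corr ψ * (corr ψ)ᵀ = (pauliExp ψ 0 0 ^ 2 - blochA ψ ⬝ᵥ blochA ψ) • 1 +
      Matrix.vecMulVec (blochA ψ) (blochA ψ) := by
  ext i j
  simp only [Matrix.mul_apply, Matrix.add_apply, Matrix.smul_apply, Matrix.vecMulVec_apply,
    Matrix.transpose_apply, dotProduct, Fin.sum_univ_three, smul_eq_mul, corr,
    blochA, pauliExp_eq_coordExp]
  generalize reCoord ψ = x
  generalize imCoord ψ = y
  fin_cases i <;> fin_cases j <;> simp [coordExp] <;> ring

theorem corr_transpose_mul_hom (ψ : TwoQubit) :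
    (corr ψ)ᵀ * corr ψ = (pauliExp ψ 0 0 ^ 2 - blochA ψ ⬝ᵥ blochA ψ) • 1 +
      Matrix.vecMulVec (blochB ψ) (blochB ψ) := by
  ext i j
  simp only [Matrix.mul_apply, Matrix.add_apply, Matrix.smul_apply, Matrix.vecMulVec_apply,
    Matrix.transpose_apply, dotProduct, Fin.sum_univ_three, smul_eq_mul, corr,
    blochA, blochB, pauliExp_eq_coordExp]
  generalize reCoord ψ = x
  generalize imCoord ψ = y
  fin_cases i <;> fin_cases j <;> simp [coordExp] <;> ring

theorem blochA_dot_eq_blochB_dot (ψ : TwoQubit) :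
    blochA ψ ⬝ᵥ blochA ψ = blochB ψ ⬝ᵥ blochB ψ := by
  simp only [dotProduct, Fin.sum_univ_three, blochA, blochB, pauliExp_eq_coordExp]
  generalize reCoord ψ = x
  generalize imCoord ψ = y
  simp [coordExp]
  ring

/-- For α ≠ 0 this is the relation that forces C, in frames adapted to α and β, to be a scaled plane
reflection off the axis. -/
theorem crossMat_mul_corr (ψ : TwoQubit) :
    crossMat (blochA ψ) * corr ψ = - (corr ψ * crossMat (blochB ψ)) := by
  ext i j
  simp only [Matrix.mul_apply, Matrix.neg_apply, Fin.sum_univ_three, corr,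
    blochA, blochB, pauliExp_eq_coordExp, crossMat]
  generalize reCoord ψ = x
  generalize imCoord ψ = y
  fin_cases i <;> fin_cases j <;> simp [coordExp] <;> ring

/-- The last row of the cofactor matrix of the correlation matrix. -/
theorem cross_rows_corr_hom (ψ : TwoQubit) :
    crossMat (corr ψ 0) *ᵥ corr ψ 1 =
      blochA ψ 2 • blochB ψ - pauliExp ψ 0 0 • corr ψ 2 := by
  ext i
  simp only [Matrix.mulVec, dotProduct, Fin.sum_univ_three, Pi.smul_apply, smul_eq_mul, corr,
    blochA, blochB, pauliExp_eq_coordExp, Pi.sub_apply, crossMat]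
  generalize reCoord ψ = x
  generalize imCoord ψ = y
  fin_cases i <;> simp [coordExp] <;> ring

/-- For a unit vector the right side is the squared concurrence; it gives both μ ≤ 1 and the
criterion for product states. -/
theorem one_sub_blochA_dot_hom (ψ : TwoQubit) :
    pauliExp ψ 0 0 ^ 2 - blochA ψ ⬝ᵥ blochA ψ =
      4 * Complex.normSq (ψ (0, 0) * ψ (1, 1) - ψ (0, 1) * ψ (1, 0)) := by
  simp only [dotProduct, Fin.sum_univ_three, blochA, pauliExp_eq_coordExp]
  simp [coordExp, reCoord, imCoord, Complex.normSq_apply]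
  ring

end relations

/-! ### Quaternions acting on either qubit, and the induced rotations -/

section action

variable (x : ℝ) (n : Fin 3 → ℝ) (ψ : TwoQubit)

theorem reCoord_actA : reCoord (actA x n ψ) =
    ![x * reCoord ψ 0 + n 2 * imCoord ψ 0 + n 0 * imCoord ψ 2 - n 1 * reCoord ψ 2,
      x * reCoord ψ 1 + n 2 * imCoord ψ 1 + n 0 * imCoord ψ 3 - n 1 * reCoord ψ 3,
      x * reCoord ψ 2 - n 2 * imCoord ψ 2 + n 0 * imCoord ψ 0 + n 1 * reCoord ψ 0,
      x * reCoord ψ 3 - n 2 * imCoord ψ 3 + n 0 * imCoord ψ 1 + n 1 * reCoord ψ 1] := by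
  ext i
  fin_cases i <;> simp [reCoord, imCoord, actA, quatMat] <;> ring

theorem imCoord_actA : imCoord (actA x n ψ) =
    ![x * imCoord ψ 0 - n 2 * reCoord ψ 0 - n 0 * reCoord ψ 2 - n 1 * imCoord ψ 2,
      x * imCoord ψ 1 - n 2 * reCoord ψ 1 - n 0 * reCoord ψ 3 - n 1 * imCoord ψ 3,
      x * imCoord ψ 2 + n 2 * reCoord ψ 2 - n 0 * reCoord ψ 0 + n 1 * imCoord ψ 0,
      x * imCoord ψ 3 + n 2 * reCoord ψ 3 - n 0 * reCoord ψ 1 + n 1 * imCoord ψ 1] := by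
  ext i
  fin_cases i <;> simp [reCoord, imCoord, actA, quatMat] <;> ring

theorem reCoord_actB : reCoord (actB x n ψ) =
    ![x * reCoord ψ 0 + n 2 * imCoord ψ 0 + n 0 * imCoord ψ 1 - n 1 * reCoord ψ 1,
      x * reCoord ψ 1 - n 2 * imCoord ψ 1 + n 0 * imCoord ψ 0 + n 1 * reCoord ψ 0,
      x * reCoord ψ 2 + n 2 * imCoord ψ 2 + n 0 * imCoord ψ 3 - n 1 * reCoord ψ 3,
      x * reCoord ψ 3 - n 2 * imCoord ψ 3 + n 0 * imCoord ψ 2 + n 1 * reCoord ψ 2] := by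
  ext i
  fin_cases i <;> simp [reCoord, imCoord, actB, quatMat] <;> ring

theorem imCoord_actB : imCoord (actB x n ψ) =
    ![x * imCoord ψ 0 - n 2 * reCoord ψ 0 - n 0 * reCoord ψ 1 - n 1 * imCoord ψ 1,
      x * imCoord ψ 1 + n 2 * reCoord ψ 1 - n 0 * reCoord ψ 0 + n 1 * imCoord ψ 0,
      x * imCoord ψ 2 - n 2 * reCoord ψ 2 - n 0 * reCoord ψ 3 - n 1 * imCoord ψ 3,
      x * imCoord ψ 3 + n 2 * reCoord ψ 3 - n 0 * reCoord ψ 2 + n 1 * imCoord ψ 2] := by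
  ext i
  fin_cases i <;> simp [reCoord, imCoord, actB, quatMat] <;> ring

theorem pauliExp_actA_zero (j : Fin 4) :
    pauliExp (actA x n ψ) 0 j = (x ^ 2 + n ⬝ᵥ n) * pauliExp ψ 0 j := by
  simp only [pauliExp_eq_coordExp, reCoord_actA, imCoord_actA, dotProduct, Fin.sum_univ_three]
  generalize reCoord ψ = u
  generalize imCoord ψ = v
  fin_cases j <;> simp [coordExp] <;> ring

theorem pauliExp_actB_zero (i : Fin 4) :
    pauliExp (actB x n ψ) i 0 = (x ^ 2 + n ⬝ᵥ n) * pauliExp ψ i 0 := by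
  simp only [pauliExp_eq_coordExp, reCoord_actB, imCoord_actB, dotProduct, Fin.sum_univ_three]
  generalize reCoord ψ = u
  generalize imCoord ψ = v
  fin_cases i <;> simp [coordExp] <;> ring

theorem pauliExp_actA_succ (i : Fin 3) (j : Fin 4) :
    pauliExp (actA x n ψ) i.succ j = ∑ k : Fin 3, quatRot x n i k * pauliExp ψ k.succ j := by
  simp only [pauliExp_eq_coordExp, reCoord_actA, imCoord_actA, quatRot, dotProduct,
    Fin.sum_univ_three, Matrix.add_apply, Matrix.smul_apply, Matrix.vecMulVec_apply, smul_eq_mul]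
  generalize reCoord ψ = u
  generalize imCoord ψ = v
  fin_cases i <;> fin_cases j <;> simp [coordExp, crossMat, Matrix.one_apply] <;> ring

theorem pauliExp_actB_succ (i : Fin 4) (j : Fin 3) :
    pauliExp (actB x n ψ) i j.succ = ∑ k : Fin 3, quatRot x n j k * pauliExp ψ i k.succ := by
  simp only [pauliExp_eq_coordExp, reCoord_actB, imCoord_actB, quatRot, dotProduct,
    Fin.sum_univ_three, Matrix.add_apply, Matrix.smul_apply, Matrix.vecMulVec_apply, smul_eq_mul]
  generalize reCoord ψ = u
  generalize imCoord ψ = v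
  fin_cases j <;> fin_cases i <;> simp [coordExp, crossMat, Matrix.one_apply] <;> ring

end action

/-! ### The same relations for unit vectors and unit quaternions -/

section normalized

variable {ψ : TwoQubit}

theorem IsPureState.pauliExp_zero (h : IsPureState ψ) : pauliExp ψ 0 0 = 1 :=
  (isPureState_iff ψ).1 h

theorem IsPureState.corr_mulVec_blochB (h : IsPureState ψ) :
    corr ψ *ᵥ blochB ψ = blochA ψ := by
  simpa [h.pauliExp_zero] using corr_mulVec_blochB_hom ψ

theorem IsPureState.corr_mul_transpose (h : IsPureState ψ) :
    corr ψ * (corr ψ)ᵀ = (1 - blochA ψ ⬝ᵥ blochA ψ) • 1 +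
      Matrix.vecMulVec (blochA ψ) (blochA ψ) := by
  simpa [h.pauliExp_zero] using corr_mul_transpose_hom ψ

theorem IsPureState.corr_transpose_mul (h : IsPureState ψ) :
    (corr ψ)ᵀ * corr ψ = (1 - blochA ψ ⬝ᵥ blochA ψ) • 1 +
      Matrix.vecMulVec (blochB ψ) (blochB ψ) := by
  simpa [h.pauliExp_zero] using corr_transpose_mul_hom ψ

theorem IsPureState.cross_rows_corr (h : IsPureState ψ) :
    crossMat (corr ψ 0) *ᵥ corr ψ 1 = blochA ψ 2 • blochB ψ - corr ψ 2 := by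
  simpa [h.pauliExp_zero] using cross_rows_corr_hom ψ

theorem IsPureState.one_sub_blochA_dot (h : IsPureState ψ) :
    1 - blochA ψ ⬝ᵥ blochA ψ =
      4 * Complex.normSq (ψ (0, 0) * ψ (1, 1) - ψ (0, 1) * ψ (1, 0)) := by
  simpa [h.pauliExp_zero] using one_sub_blochA_dot_hom ψ

variable {x : ℝ} {n : Fin 3 → ℝ}

theorem IsPureState.actA (h : IsPureState ψ) (hn : x ^ 2 + n ⬝ᵥ n = 1) :
    IsPureState (actA x n ψ) := by
  rw [isPureState_iff, pauliExp_actA_zero, hn, h.pauliExp_zero, one_mul]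

theorem IsPureState.actB (h : IsPureState ψ) (hn : x ^ 2 + n ⬝ᵥ n = 1) :
    IsPureState (actB x n ψ) := by
  rw [isPureState_iff, pauliExp_actB_zero, hn, h.pauliExp_zero, one_mul]

theorem blochA_actA : blochA (actA x n ψ) = quatRot x n *ᵥ blochA ψ :=
  funext fun i => pauliExp_actA_succ x n ψ i 0

theorem blochB_actA (hn : x ^ 2 + n ⬝ᵥ n = 1) : blochB (actA x n ψ) = blochB ψ :=
  funext fun i => by simp [blochB, pauliExp_actA_zero, hn]

theorem corr_actA : corr (actA x n ψ) = quatRot x n * corr ψ := by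
  ext i j
  exact pauliExp_actA_succ x n ψ i j.succ

theorem blochA_actB (hn : x ^ 2 + n ⬝ᵥ n = 1) : blochA (actB x n ψ) = blochA ψ :=
  funext fun i => by simp [blochA, pauliExp_actB_zero, hn]

theorem blochB_actB : blochB (actB x n ψ) = quatRot x n *ᵥ blochB ψ :=
  funext fun i => pauliExp_actB_succ x n ψ 0 i

theorem corr_actB_row (i : Fin 3) : corr (actB x n ψ) i = quatRot x n *ᵥ corr ψ i :=
  funext fun j => pauliExp_actB_succ x n ψ i.succ j

end normalized

/-! ### Closed forms of the divergence -/

section chiSq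

theorem chiSq_self (b : ℝ) : chiSq b b = 0 := by
  unfold chiSq
  by_cases h1 : b = 1
  -- The convention 0/0 = 0 is what makes the term vanish at b = h = ±1.
  · norm_num [h1]
  by_cases h2 : b = -1
  · norm_num [h2]
  have h1' : 1 - b ≠ 0 := sub_ne_zero.2 (Ne.symm h1)
  have h2' : b + 1 ≠ 0 := fun h => h2 (by linarith)
  field_simp
  ring

theorem chiSq_eq {b h : ℝ} (hh : h ^ 2 < 1) : chiSq b h = (b - h) ^ 2 / (1 - h ^ 2) := by
  have h1 : 1 - h ≠ 0 := fun e => by nlinarith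
  have h2 : h + 1 ≠ 0 := fun e => by nlinarith
  have h3 : 1 - h ^ 2 ≠ 0 := by nlinarith
  have h4 : 1 - h ^ 2 = (1 - h) * (h + 1) := by ring
  unfold chiSq
  rw [h4] at h3 ⊢
  field_simp
  ring

theorem chiSq_zero (b : ℝ) : chiSq b 0 = b ^ 2 := by
  rw [chiSq_eq (by norm_num)]
  simp

end chiSq

/-! ### Midpoints from symmetry of the feasible set -/

section midpoint

/-- The midpoint of the feasible values of component `k`. -/
def blochMid (ψ : TwoQubit) (k : Fin 16) : ℝ := (blochMax ψ k + blochMin ψ k) / 2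

variable {ψ : TwoQubit} {k : Fin 16}

theorem bloch_mem_feasible (hψ : IsPureState ψ) : bloch ψ k ∈ feasible ψ k :=
  ⟨ψ, hψ, fun _ _ => rfl, rfl⟩

/-- The map x ↦ 2h - x sends the maximum to a feasible value, hence at least the minimum, and
conversely. This needs the extremes to be attained. -/
theorem blochMid_eq_of_symm {h : ℝ} (hψ : IsPureState ψ)
    (H : ∀ x ∈ feasible ψ k, 2 * h - x ∈ feasible ψ k) : blochMid ψ k = h := by
  have hM := isGreatest_blochMax hψ k
  have hm := isLeast_blochMin hψ k
  have h1 := hm.2 (H _ hM.1)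
  have h2 := hM.2 (H _ hm.1)
  unfold blochMid
  linarith

theorem blochMid_eq_of_unitary {h : ℝ} (hψ : IsPureState ψ)
    (H : ∀ φ, IsPureState φ → (∀ j < k, bloch φ j = bloch ψ j) →
      ∃ φ', IsPureState φ' ∧ (∀ j < k, bloch φ' j = bloch φ j) ∧
        bloch φ' k = 2 * h - bloch φ k) : blochMid ψ k = h := by
  refine blochMid_eq_of_symm hψ ?_
  rintro x ⟨φ, hφ, hj, rfl⟩
  obtain ⟨φ', h1, h2, h3⟩ := H φ hφ hj
  exact ⟨φ', h1, fun j hjk => (h2 j hjk).trans (hj j hjk), h3⟩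

theorem chiSq_bloch_eq_zero (hψ : IsPureState ψ)
    (H : ∀ φ, IsPureState φ → (∀ j < k, bloch φ j = bloch ψ j) → bloch φ k = bloch ψ k) :
    chiSq (bloch ψ k) (blochMid ψ k) = 0 := by
  have : blochMid ψ k = bloch ψ k := by
    refine blochMid_eq_of_symm hψ ?_
    rintro x ⟨φ, hφ, hj, rfl⟩
    rw [H φ hφ hj]
    convert bloch_mem_feasible hψ (k := k) using 1
    ring
  rw [this, chiSq_self]

end midpoint

/-! ### Half-turns of three-dimensional space -/

section vectors

theorem quatRot_mulVec_zero (n v : Fin 3 → ℝ) (hn : n ⬝ᵥ n = 1) (i : Fin 3) :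
    (quatRot 0 n *ᵥ v) i = 2 * (n ⬝ᵥ v) * n i - v i := by
  simp only [quatRot, hn]
  fin_cases i <;>
    simp [Matrix.mulVec, dotProduct, Fin.sum_univ_three, Matrix.vecMulVec_apply,
      Matrix.one_apply] <;> ring

/-- A half-turn can keep the components before the `i`-th and negate the `i`-th. -/
theorem exists_half_turn (v : Fin 3 → ℝ) (i : Fin 3) :
    ∃ n : Fin 3 → ℝ, n ⬝ᵥ n = 1 ∧ (∀ j < i, (quatRot 0 n *ᵥ v) j = v j) ∧
      (quatRot 0 n *ᵥ v) i = - v i := by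
  suffices H : ∃ n : Fin 3 → ℝ, n ⬝ᵥ n = 1 ∧ (∀ j < i, 2 * (n ⬝ᵥ v) * n j - v j = v j) ∧
      2 * (n ⬝ᵥ v) * n i - v i = - v i by
    obtain ⟨n, hn, h1, h2⟩ := H
    refine ⟨n, hn, fun j hj => ?_, ?_⟩ <;> rw [quatRot_mulVec_zero n v hn]
    exacts [h1 j hj, h2]
  -- If the first two coordinates vanish, the axis e₁ serves every i. Otherwise the axes are e₃, e₁
  -- and the normalized projection of v to the first two coordinates.
  by_cases h : v 0 ^ 2 + v 1 ^ 2 = 0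
  · have h0 : v 0 = 0 := by nlinarith [sq_nonneg (v 0), sq_nonneg (v 1)]
    have h1 : v 1 = 0 := by nlinarith [sq_nonneg (v 0), sq_nonneg (v 1)]
    refine ⟨![1, 0, 0], by simp, fun j hj => ?_, ?_⟩
    · fin_cases i <;> fin_cases j <;> simp_all [dotProduct, Fin.sum_univ_three]
    · fin_cases i <;> simp [h0, dotProduct, Fin.sum_univ_three]
  match i with
  | 0 => exact ⟨![0, 0, 1], by simp, by simp, by simp⟩
  | 1 =>
    refine ⟨![1, 0, 0], by simp, fun j hj => ?_, by simp⟩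
    have : j = 0 := by omega
    subst this
    simp [dotProduct, Fin.sum_univ_three]
    ring
  | 2 =>
    have hp : 0 < v 0 ^ 2 + v 1 ^ 2 := lt_of_le_of_ne (by positivity) (Ne.symm h)
    have hs := Real.sq_sqrt hp.le
    set s := √(v 0 ^ 2 + v 1 ^ 2) with hsdef
    have hs0 : s ≠ 0 := (Real.sqrt_pos.2 hp).ne'
    have hd : ![v 0 / s, v 1 / s, 0] ⬝ᵥ v = s := by
      simp [dotProduct, Fin.sum_univ_three]
      field_simp
      linarith
    refine ⟨![v 0 / s, v 1 / s, 0], ?_, fun j hj => ?_, by simp⟩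
    · simp [dotProduct, Fin.sum_univ_three]
      field_simp
      linarith
    · rw [hd]
      have : j = 0 ∨ j = 1 := by omega
      rcases this with rfl | rfl <;> simp <;> field_simp <;> ring

end vectors

/-! ### The six local components -/

section localStages

variable {ψ φ : TwoQubit}

theorem bloch_lt_seven_iff (hφ : IsPureState φ) (hψ : IsPureState ψ) :
    (∀ j < 7, bloch φ j = bloch ψ j) ↔ blochA φ = blochA ψ ∧ blochB φ = blochB ψ := by
  constructor
  · intro h
    constructor <;> ext i <;> fin_cases i
    exacts [h 1 (by decide), h 2 (by decide), h 3 (by decide), h 4 (by decide), h 5 (by decide),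
      h 6 (by decide)]
  · rintro ⟨hA, hB⟩ j hj
    have h0 : bloch φ 0 = bloch ψ 0 := hφ.pauliExp_zero.trans hψ.pauliExp_zero.symm
    have e : j = 0 ∨ j = 1 ∨ j = 2 ∨ j = 3 ∨ j = 4 ∨ j = 5 ∨ j = 6 := by omega
    rcases e with rfl | rfl | rfl | rfl | rfl | rfl | rfl
    exacts [h0, congrFun hA 0, congrFun hA 1, congrFun hA 2, congrFun hB 0, congrFun hB 1,
      congrFun hB 2]

theorem blochMid_A (hψ : IsPureState ψ) (i : Fin 3) :
    blochMid ψ (⟨i + 1, by omega⟩ : Fin 16) = 0 := by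
  refine blochMid_eq_of_unitary hψ fun φ hφ _ => ?_
  obtain ⟨n, hn, h1, h2⟩ := exists_half_turn (blochA φ) i
  have hn' : (0 : ℝ) ^ 2 + n ⬝ᵥ n = 1 := by simp [hn]
  rw [← blochA_actA] at h1 h2
  have h0 : bloch (actA 0 n φ) 0 = bloch φ 0 :=
    (hφ.actA hn').pauliExp_zero.trans hφ.pauliExp_zero.symm
  refine ⟨actA 0 n φ, hφ.actA hn', fun j hj => ?_, ?_⟩
  · match i with
    | 0 =>
      obtain rfl : j = 0 := by change j.1 < 1 at hj; omega
      exact h0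
    | 1 =>
      have : j = 0 ∨ j = 1 := by change j.1 < 2 at hj; omega
      rcases this with rfl | rfl
      exacts [h0, h1 0 (by decide)]
    | 2 =>
      have : j = 0 ∨ j = 1 ∨ j = 2 := by change j.1 < 3 at hj; omega
      rcases this with rfl | rfl | rfl
      exacts [h0, h1 0 (by decide), h1 1 (by decide)]
  · rw [mul_zero, zero_sub]
    fin_cases i <;> exact h2

theorem blochMid_B (hψ : IsPureState ψ) (i : Fin 3) :
    blochMid ψ (⟨i + 4, by omega⟩ : Fin 16) = 0 := by
  refine blochMid_eq_of_unitary hψ fun φ hφ _ => ?_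
  obtain ⟨n, hn, h1, h2⟩ := exists_half_turn (blochB φ) i
  have hn' : (0 : ℝ) ^ 2 + n ⬝ᵥ n = 1 := by simp [hn]
  rw [← blochB_actB] at h1 h2
  have h0 : ∀ j < 4, bloch (actB 0 n φ) j = bloch φ j := by
    intro j hj
    have : j = 0 ∨ j = 1 ∨ j = 2 ∨ j = 3 := by omega
    have hA := blochA_actB (ψ := φ) hn'
    rcases this with rfl | rfl | rfl | rfl
    exacts [(hφ.actB hn').pauliExp_zero.trans hφ.pauliExp_zero.symm, congrFun hA 0,
      congrFun hA 1, congrFun hA 2]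
  refine ⟨actB 0 n φ, hφ.actB hn', fun j hj => ?_, ?_⟩
  · by_cases hj4 : j < 4
    · exact h0 j hj4
    match i with
    | 0 => exact absurd hj hj4
    | 1 =>
      obtain rfl : j = 4 := by change j.1 < 5 at hj; omega
      exact h1 0 (by decide)
    | 2 =>
      have : j = 4 ∨ j = 5 := by change j.1 < 6 at hj; omega
      rcases this with rfl | rfl
      exacts [h1 0 (by decide), h1 1 (by decide)]
  · rw [mul_zero, zero_sub]
    fin_cases i <;> exact h2

/-- The contribution of component `k` to the information content. -/
def infoTerm (ψ : TwoQubit) (k : Fin 16) : ℝ := chiSq (bloch ψ k) (blochMid ψ k)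

theorem sum_succ_eq_local_add_corr (f : Fin 16 → ℝ) : ∑ k : Fin 15, f k.succ =
    f 1 + f 2 + f 3 + f 4 + f 5 + f 6 + ∑ k : Fin 9, f (k.natAdd 7) := by
  rw [Fin.sum_univ_add (a := 6) (b := 9) fun k : Fin (6 + 9) => f k.succ, Fin.sum_univ_six]
  rfl

/-- The local components contribute `2μ²`. -/
theorem postInfo_eq (hψ : IsPureState ψ) :
    postInfo ψ = 2 * (blochA ψ ⬝ᵥ blochA ψ) + ∑ k : Fin 9, infoTerm ψ (k.natAdd 7) := by
  have hA0 : infoTerm ψ 1 = blochA ψ 0 ^ 2 := by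
    rw [infoTerm, show blochMid ψ 1 = 0 from blochMid_A hψ 0, chiSq_zero]; rfl
  have hA1 : infoTerm ψ 2 = blochA ψ 1 ^ 2 := by
    rw [infoTerm, show blochMid ψ 2 = 0 from blochMid_A hψ 1, chiSq_zero]; rfl
  have hA2 : infoTerm ψ 3 = blochA ψ 2 ^ 2 := by
    rw [infoTerm, show blochMid ψ 3 = 0 from blochMid_A hψ 2, chiSq_zero]; rfl
  have hB0 : infoTerm ψ 4 = blochB ψ 0 ^ 2 := by
    rw [infoTerm, show blochMid ψ 4 = 0 from blochMid_B hψ 0, chiSq_zero]; rfl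
  have hB1 : infoTerm ψ 5 = blochB ψ 1 ^ 2 := by
    rw [infoTerm, show blochMid ψ 5 = 0 from blochMid_B hψ 1, chiSq_zero]; rfl
  have hB2 : infoTerm ψ 6 = blochB ψ 2 ^ 2 := by
    rw [infoTerm, show blochMid ψ 6 = 0 from blochMid_B hψ 2, chiSq_zero]; rfl
  have e := sum_succ_eq_local_add_corr (infoTerm ψ)
  have hAB := blochA_dot_eq_blochB_dot ψ
  have h2 : 2 * (blochA ψ ⬝ᵥ blochA ψ) = blochA ψ ⬝ᵥ blochA ψ + blochB ψ ⬝ᵥ blochB ψ := by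
    linarith
  rw [show postInfo ψ = ∑ k : Fin 15, infoTerm ψ k.succ from rfl, e, h2, hA0, hA1, hA2, hB0,
    hB1, hB2]
  simp only [dotProduct, Fin.sum_univ_three]
  ring

theorem localNorm_sq (ψ : TwoQubit) : localNorm ψ ^ 2 = blochA ψ ⬝ᵥ blochA ψ := by
  rw [localNorm, Real.sq_sqrt (by positivity)]
  simp only [dotProduct, Fin.sum_univ_three, blochA]
  simp
  ring

end localStages

/-! ### The extreme values of μ -/

section localNorm

variable {ψ : TwoQubit}

theorem localNorm_le_one (hψ : IsPureState ψ) : localNorm ψ ≤ 1 := by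
  have h1 := localNorm_sq ψ
  have h2 := hψ.one_sub_blochA_dot
  have h3 := Complex.normSq_nonneg (ψ (0, 0) * ψ (1, 1) - ψ (0, 1) * ψ (1, 0))
  have h4 : 0 ≤ localNorm ψ := Real.sqrt_nonneg _
  nlinarith

theorem isProductState_iff (ψ : TwoQubit) :
    IsProductState ψ ↔ ψ (0, 0) * ψ (1, 1) - ψ (0, 1) * ψ (1, 0) = 0 := by
  constructor
  · rintro ⟨u, v, h⟩
    simp only [h]
    ring
  · intro h
    by_cases h0 : ψ (0, 0) = 0
    · have h1 : ψ (0, 1) * ψ (1, 0) = 0 := by simpa [h0] using h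
      rcases mul_eq_zero.1 h1 with h1 | h1
      · refine ⟨![0, 1], ![ψ (1, 0), ψ (1, 1)], fun i j => ?_⟩
        fin_cases i <;> fin_cases j <;> simp [h0, h1]
      · refine ⟨![ψ (0, 1), ψ (1, 1)], ![0, 1], fun i j => ?_⟩
        fin_cases i <;> fin_cases j <;> simp [h0, h1]
    · refine ⟨![1, ψ (1, 0) / ψ (0, 0)], ![ψ (0, 0), ψ (0, 1)], fun i j => ?_⟩
      have h1 : ψ (1, 1) = ψ (1, 0) / ψ (0, 0) * ψ (0, 1) := by
        field_simp
        linear_combination h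
      fin_cases i <;> fin_cases j <;> simp [h1, h0]

theorem blochA_dot_eq_one_iff (hψ : IsPureState ψ) :
    blochA ψ ⬝ᵥ blochA ψ = 1 ↔ IsProductState ψ := by
  rw [isProductState_iff, ← Complex.normSq_eq_zero]
  have := hψ.one_sub_blochA_dot
  constructor <;> intro h <;> linarith

theorem localNorm_eq_one_iff (hψ : IsPureState ψ) : localNorm ψ = 1 ↔ IsProductState ψ := by
  rw [← blochA_dot_eq_one_iff hψ, ← localNorm_sq,
    pow_eq_one_iff_of_nonneg (show 0 ≤ localNorm ψ from Real.sqrt_nonneg _) two_ne_zero]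

theorem localNorm_eq_zero_iff_blochA (ψ : TwoQubit) : localNorm ψ = 0 ↔ blochA ψ = 0 := by
  rw [← dotProduct_self_eq_zero, ← localNorm_sq, sq_eq_zero_iff]

theorem localNorm_eq_zero_iff (hψ : IsPureState ψ) : localNorm ψ = 0 ↔ IsMaxEntangled ψ := by
  rw [localNorm_eq_zero_iff_blochA]
  have h0 := hψ.pauliExp_zero
  simp only [pauliExp_eq_coordExp] at h0
  simp only [funext_iff, Fin.forall_fin_succ, IsMaxEntangled, blochA, pauliExp_eq_coordExp]
  simp [coordExp, reCoord, imCoord, Complex.ext_iff] at h0 ⊢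
  constructor
  · rintro ⟨h1, h2, h3⟩
    refine ⟨⟨⟨?_, ?_⟩, ?_, ?_⟩, ⟨?_, ?_⟩, ?_, ?_⟩ <;> linarith
  · rintro ⟨⟨⟨h1, h2⟩, h3, h4⟩, ⟨h5, h6⟩, h7, h8⟩
    refine ⟨?_, ?_, ?_⟩ <;> linarith

end localNorm

/-! ### Product states -/

section product

variable {ψ : TwoQubit}

/-- With CCᵀ = ααᵀ, Cβ = α and ‖β‖ = 1, the product (C - αβᵀ)(C - αβᵀ)ᵀ expands to 0. -/
theorem IsPureState.corr_of_dot_eq_one (hψ : IsPureState ψ) (h : blochA ψ ⬝ᵥ blochA ψ = 1) :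
    corr ψ = Matrix.vecMulVec (blochA ψ) (blochB ψ) := by
  have hB : blochB ψ ⬝ᵥ blochB ψ = 1 := by rw [← blochA_dot_eq_blochB_dot, h]
  have h1 := hψ.corr_mul_transpose
  rw [h, sub_self, zero_smul, zero_add] at h1
  have h2 := hψ.corr_mulVec_blochB
  rw [← sub_eq_zero, ← Matrix.self_mul_conjTranspose_eq_zero,
    Matrix.conjTranspose_eq_transpose_of_trivial,
    Matrix.transpose_sub, Matrix.transpose_vecMulVec, Matrix.mul_sub, Matrix.sub_mul,
    Matrix.sub_mul, h1, Matrix.mul_vecMulVec, h2, Matrix.vecMulVec_mul_vecMulVec,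
    Matrix.vecMulVec_mul, Matrix.vecMul_transpose, h2, hB]
  simp

theorem bloch_natAdd_eq_corr (k : Fin 9) :
    ∃ i j, ∀ ψ, bloch ψ (k.natAdd 7) = corr ψ i j := by
  fin_cases k
  exacts [⟨0, 0, fun _ => rfl⟩, ⟨0, 1, fun _ => rfl⟩, ⟨0, 2, fun _ => rfl⟩,
    ⟨1, 0, fun _ => rfl⟩, ⟨1, 1, fun _ => rfl⟩, ⟨1, 2, fun _ => rfl⟩,
    ⟨2, 0, fun _ => rfl⟩, ⟨2, 1, fun _ => rfl⟩, ⟨2, 2, fun _ => rfl⟩]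

theorem postInfo_of_dot_eq_one (hψ : IsPureState ψ) (h : blochA ψ ⬝ᵥ blochA ψ = 1) :
    postInfo ψ = 2 := by
  rw [postInfo_eq hψ, h, Finset.sum_eq_zero, mul_one, add_zero]
  intro k _
  refine chiSq_bloch_eq_zero hψ fun φ hφ hj => ?_
  obtain ⟨hA, hB⟩ := (bloch_lt_seven_iff hφ hψ).1 fun j hj' =>
    hj j (lt_of_lt_of_le hj' (Fin.le_def.2 (by simp)))
  obtain ⟨i, j, hij⟩ := bloch_natAdd_eq_corr k
  rw [hij, hij, hψ.corr_of_dot_eq_one h, hφ.corr_of_dot_eq_one (hA ▸ h), hA, hB]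

end product

/-! ### Adapted frames and the normal form of C -/

section frames

/-- The quarter-turn about the third axis. -/
def quarterTurn : Matrix (Fin 3) (Fin 3) ℝ := !![0, -1, 0; 1, 0, 0; 0, 0, 0]

theorem exists_unit_perp (a : Fin 3 → ℝ) : ∃ n : Fin 3 → ℝ, n ⬝ᵥ n = 1 ∧ n ⬝ᵥ a = 0 := by
  by_cases h : a 0 ^ 2 + a 1 ^ 2 = 0
  · have h0 : a 0 = 0 := by nlinarith [sq_nonneg (a 0), sq_nonneg (a 1)]
    exact ⟨![1, 0, 0], by simp, by simp [dotProduct, Fin.sum_univ_three, h0]⟩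
  · have hp : 0 < a 0 ^ 2 + a 1 ^ 2 := lt_of_le_of_ne (by positivity) (Ne.symm h)
    have hs := Real.sq_sqrt hp.le
    have hs0 := (Real.sqrt_pos.2 hp).ne'
    set s := √(a 0 ^ 2 + a 1 ^ 2)
    refine ⟨![-a 1 / s, a 0 / s, 0], ?_, ?_⟩
    · simp [dotProduct, Fin.sum_univ_three]
      field_simp
      linarith
    · simp [dotProduct, Fin.sum_univ_three]
      ring

/-- A unit vector is the last vector of a right-handed orthonormal frame. -/
theorem exists_frame {a : Fin 3 → ℝ} (ha : a ⬝ᵥ a = 1) :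
    ∃ P : Matrix (Fin 3) (Fin 3) ℝ, P * Pᵀ = 1 ∧ Pᵀ * P = 1 ∧ (∀ i, P i 2 = a i) ∧
      crossMat a * P = P * quarterTurn := by
  obtain ⟨n, hn, hna⟩ := exists_unit_perp a
  simp only [dotProduct, Fin.sum_univ_three] at ha hn hna
  -- The columns are n, a × n and a.
  let P : Matrix (Fin 3) (Fin 3) ℝ := !![n 0, a 1 * n 2 - a 2 * n 1, a 0;
    n 1, a 2 * n 0 - a 0 * n 2, a 1; n 2, a 0 * n 1 - a 1 * n 0, a 2]
  have h1 : Pᵀ * P = 1 := by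
    ext i j
    fin_cases i <;> fin_cases j <;>
      simp [P, Matrix.mul_apply, Fin.sum_univ_three]
    · linear_combination hn
    · ring
    · linear_combination hna
    · ring
    · linear_combination (a 0 * a 0 + a 1 * a 1 + a 2 * a 2) * hn + ha -
        (n 0 * a 0 + n 1 * a 1 + n 2 * a 2) * hna
    · ring
    · linear_combination hna
    · ring
    · linear_combination ha
  refine ⟨P, mul_eq_one_comm.1 h1, h1, fun i => by fin_cases i <;> rfl, ?_⟩
  ext i j
  fin_cases i <;> fin_cases j <;>
    simp [P, Matrix.mul_apply, Fin.sum_univ_three, crossMat, quarterTurn]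
  · ring
  · linear_combination a 0 * hna - n 0 * ha
  · ring
  · ring
  · linear_combination a 1 * hna - n 1 * ha
  · ring
  · ring
  · linear_combination a 2 * hna - n 2 * ha
  · ring

/-- A rotation by θ comes from a quaternion with angle θ/2. The case c = -1 is apart because the
half-angle cosine is a divisor. -/
theorem exists_half_angle {c d : ℝ} (h : c ^ 2 + d ^ 2 = 1) :
    ∃ x y : ℝ, x ^ 2 + y ^ 2 = 1 ∧ x ^ 2 - y ^ 2 = c ∧ 2 * x * y = d := by
  by_cases hc : c = -1
  · have hd : d = 0 := by rw [hc] at h; nlinarith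
    exact ⟨0, 1, by norm_num, by norm_num [hc], by norm_num [hd]⟩
  · have hc' : 0 < (1 + c) / 2 := by
      have : -1 ≤ c := by nlinarith [sq_nonneg d]
      have := lt_of_le_of_ne this (Ne.symm hc)
      linarith
    have hs := Real.sq_sqrt hc'.le
    have hs0 := (Real.sqrt_pos.2 hc').ne'
    set x := √((1 + c) / 2)
    have hy : (d / (2 * x)) ^ 2 = (1 - c) / 2 := by
      have h1c : 1 + c ≠ 0 := fun e => by simp [e] at hc'
      rw [div_pow, mul_pow, hs]
      field_simp
      linear_combination h
    exact ⟨x, d / (2 * x), by linarith, by linarith, by field_simp⟩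

/-- In adapted frames a correlation matrix is a reflection of the plane, scaled, plus the
identity on the axis. -/
def circleMat (p q : ℝ) : Matrix (Fin 3) (Fin 3) ℝ := !![p, q, 0; q, -p, 0; 0, 0, 1]

theorem frame_circleMat_apply (P Q : Matrix (Fin 3) (Fin 3) ℝ) (p q : ℝ) (i j : Fin 3) :
    (P * circleMat p q * Qᵀ) i j = P i 2 * Q j 2 + p * (P i 0 * Q j 0 - P i 1 * Q j 1) +
      q * (P i 0 * Q j 1 + P i 1 * Q j 0) := by
  simp [Matrix.mul_apply, Fin.sum_univ_three, circleMat]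
  ring

theorem crossMat_smul (t : ℝ) (a : Fin 3 → ℝ) : crossMat (t • a) = t • crossMat a := by
  ext i j
  fin_cases i <;> fin_cases j <;> simp [crossMat]

theorem crossMat_transpose (a : Fin 3 → ℝ) : (crossMat a)ᵀ = -crossMat a := by
  ext i j
  fin_cases i <;> fin_cases j <;> simp [crossMat]

theorem quarterTurn_transpose : quarterTurnᵀ = -quarterTurn := by
  ext i j
  fin_cases i <;> fin_cases j <;> simp [quarterTurn]

/-- Anticommuting with the quarter-turn kills the entries linking plane and axis and leaves a
symmetric traceless block on the plane. -/
theorem eq_circleMat_of_anticomm {K : Matrix (Fin 3) (Fin 3) ℝ}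
    (h : quarterTurn * K = -(K * quarterTurn)) (h22 : K 2 2 = 1) :
    K = circleMat (K 0 0) (K 0 1) := by
  have e (i j : Fin 3) := congrFun (congrFun h i) j
  have e00 := e 0 1
  have e01 := e 0 0
  have e02 := e 0 2
  have e12 := e 1 2
  have e20 := e 2 0
  have e21 := e 2 1
  simp [quarterTurn, Matrix.mul_apply, Fin.sum_univ_three] at e00 e01 e02 e12 e20 e21
  ext i j
  fin_cases i <;> fin_cases j <;> simp [circleMat] <;> linarith

end frames

/-! ### The circle of states with given α and β, 0 < μ < 1 -/

section family

variable {ψ φ : TwoQubit} {μ : ℝ} {a b : Fin 3 → ℝ} {P Q : Matrix (Fin 3) (Fin 3) ℝ}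

/-- Set K = PᵀCQ. Then Cb = a gives K₃₃ = 1, the cross-product relation gives anticommutation with
the quarter-turn, and the corner of KKᵀ gives the radius. Cancelling μ in the first two needs μ ≠ 0.
-/
theorem corr_eq_circleMat (hψ : IsPureState ψ) (hμ : μ ≠ 0) (ha : a ⬝ᵥ a = 1)
    (hA : blochA ψ = μ • a) (hB : blochB ψ = μ • b)
    (hP : P * Pᵀ = 1) (hP' : Pᵀ * P = 1) (hPa : ∀ i, P i 2 = a i)
    (hPc : crossMat a * P = P * quarterTurn)
    (hQ : Q * Qᵀ = 1) (hQb : ∀ i, Q i 2 = b i)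
    (hQc : crossMat b * Q = Q * quarterTurn) :
    ∃ p q, p ^ 2 + q ^ 2 = 1 - μ ^ 2 ∧ corr ψ = P * circleMat p q * Qᵀ := by
  have hCb : corr ψ *ᵥ b = a := by
    have := hψ.corr_mulVec_blochB
    rw [hA, hB, Matrix.mulVec_smul] at this
    exact smul_right_injective _ hμ this
  have hcr : crossMat a * corr ψ = -(corr ψ * crossMat b) := by
    have := crossMat_mul_corr ψ
    rw [hA, hB, crossMat_smul, crossMat_smul, Matrix.smul_mul, Matrix.mul_smul, ← smul_neg] at this
    exact smul_right_injective _ hμ this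
  have hPt : Pᵀ * crossMat a = quarterTurn * Pᵀ := by
    have := congrArg Matrix.transpose hPc
    rw [Matrix.transpose_mul, Matrix.transpose_mul, crossMat_transpose, Matrix.mul_neg] at this
    rwa [quarterTurn_transpose, Matrix.neg_mul, neg_inj] at this
  have hPa2 : Pᵀ *ᵥ a = Pi.single 2 1 := by
    have : a = P *ᵥ Pi.single 2 1 := by
      ext i
      simp [hPa]
    rw [this, Matrix.mulVec_mulVec, hP', Matrix.one_mulVec]
  have hQb2 : Q *ᵥ Pi.single 2 1 = b := by
    ext i
    simp [hQb]
  set K := Pᵀ * corr ψ * Q with hK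
  have hK22 : K 2 2 = 1 := by
    have : K *ᵥ Pi.single 2 1 = Pi.single 2 1 := by
      rw [hK, ← Matrix.mulVec_mulVec, ← Matrix.mulVec_mulVec, hQb2, hCb, hPa2]
    simpa using congrFun this 2
  have hKJ : quarterTurn * K = -(K * quarterTurn) := by
    rw [hK, Matrix.mul_assoc _ Q, ← hQc, ← Matrix.mul_assoc, ← Matrix.mul_assoc, ← hPt,
      Matrix.mul_assoc Pᵀ, hcr, Matrix.mul_neg, Matrix.neg_mul]
    simp only [Matrix.mul_assoc]
  have hCK : corr ψ = P * K * Qᵀ := by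
    rw [hK, Matrix.mul_assoc, Matrix.mul_assoc _ Q, hQ, Matrix.mul_one, ← Matrix.mul_assoc, hP,
      Matrix.one_mul]
  have hKc := eq_circleMat_of_anticomm hKJ hK22
  refine ⟨K 0 0, K 0 1, ?_, by rw [← hKc, hCK]⟩
  have hKK : K * Kᵀ =
      (1 - μ ^ 2) • 1 + μ ^ 2 • Matrix.vecMulVec (Pi.single 2 1) (Pi.single 2 1) := by
    have h1 := hψ.corr_mul_transpose
    have h2 : (μ • a) ⬝ᵥ (μ • a) = μ ^ 2 := by simp [ha, sq]
    rw [hA, h2] at h1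
    calc K * Kᵀ = Pᵀ * (corr ψ * (Q * Qᵀ) * (corr ψ)ᵀ) * P := by
          rw [hK]; simp only [Matrix.transpose_mul, Matrix.transpose_transpose, Matrix.mul_assoc]
      _ = Pᵀ * (corr ψ * (corr ψ)ᵀ) * P := by rw [hQ, Matrix.mul_one]
      _ = _ := by
        rw [h1, Matrix.mul_add, Matrix.add_mul, Matrix.mul_smul, Matrix.smul_mul, Matrix.mul_one,
          hP', Matrix.mul_vecMulVec, Matrix.vecMulVec_mul, Matrix.mulVec_smul, ← hPa2,
          ← Matrix.mulVec_transpose, Matrix.mulVec_smul, Matrix.smul_vecMulVec,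
          Matrix.vecMulVec_smul, smul_smul, sq]
  have := congrFun (congrFun hKK 0) 0
  rw [hKc] at this
  simpa [Matrix.mul_apply, Fin.sum_univ_three, circleMat, Matrix.vecMulVec_apply, sq] using this

/-- Rotating the first qubit about α fixes α and β and turns (p₀, q₀) along the circle, so every
point of it is reached. -/
theorem exists_corr_eq_circleMat (hψ : IsPureState ψ) (ha : a ⬝ᵥ a = 1)
    (hA : blochA ψ = μ • a) (hμ : μ ^ 2 < 1) (hPa : ∀ i, P i 2 = a i) (hP' : Pᵀ * P = 1)
    (hPc : crossMat a * P = P * quarterTurn) {p₀ q₀ p q : ℝ} (h₀ : p₀ ^ 2 + q₀ ^ 2 = 1 - μ ^ 2)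
    (hC : corr ψ = P * circleMat p₀ q₀ * Qᵀ) (h : p ^ 2 + q ^ 2 = 1 - μ ^ 2) :
    ∃ φ, IsPureState φ ∧ blochA φ = blochA ψ ∧ blochB φ = blochB ψ ∧
      corr φ = P * circleMat p q * Qᵀ := by
  have hs : 1 - μ ^ 2 ≠ 0 := by linarith
  -- Here c and d are the cosine and sine of the angle from (p₀, q₀) to (p, q).
  obtain ⟨x, y, hxy, hc, hd⟩ := exists_half_angle
    (c := (p * p₀ + q * q₀) / (1 - μ ^ 2)) (d := (q * p₀ - p * q₀) / (1 - μ ^ 2)) (by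
      field_simp
      linear_combination (p₀ ^ 2 + q₀ ^ 2) * h + (1 - μ ^ 2) * h₀)
  have hn : x ^ 2 + (y • a) ⬝ᵥ (y • a) = 1 := by
    simp [ha]
    linarith
  have hR : quatRot x (y • a) * P = P * ((x ^ 2 - y ^ 2) • 1 +
      (2 * y ^ 2) • Matrix.vecMulVec (Pi.single 2 1) (Pi.single 2 1) +
      (2 * x * y) • quarterTurn) := by
    have hPa2 : a = P *ᵥ Pi.single 2 1 := by
      ext i
      simp [hPa]
    have haP : a ᵥ* P = Pi.single 2 1 := by
      rw [← Matrix.mulVec_transpose, hPa2, Matrix.mulVec_mulVec, hP', Matrix.one_mulVec]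
    have h2 : (y • a) ⬝ᵥ (y • a) = y ^ 2 := by simp [ha, sq]
    rw [quatRot, crossMat_smul, h2, Matrix.smul_vecMulVec, Matrix.vecMulVec_smul, Matrix.add_mul,
      Matrix.add_mul, Matrix.mul_add, Matrix.mul_add]
    simp only [Matrix.smul_mul, Matrix.mul_smul, Matrix.one_mul, Matrix.mul_one, hPc,
      Matrix.vecMulVec_mul, haP, Matrix.mul_vecMulVec, ← hPa2, smul_smul]
    module
  have hRa : quatRot x (y • a) *ᵥ blochA ψ = blochA ψ := by
    have hPa2 : a = P *ᵥ Pi.single 2 1 := by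
      ext i
      simp [hPa]
    have hfix : ((x ^ 2 - y ^ 2) • (1 : Matrix (Fin 3) (Fin 3) ℝ) +
        (2 * y ^ 2) • Matrix.vecMulVec (Pi.single 2 1) (Pi.single 2 1) +
        (2 * x * y) • quarterTurn) *ᵥ Pi.single 2 1 = Pi.single 2 1 := by
      ext i
      fin_cases i <;> simp [quarterTurn, Matrix.vecMulVec_apply]
      linarith
    have hRa : quatRot x (y • a) *ᵥ (P *ᵥ Pi.single 2 1) = P *ᵥ Pi.single 2 1 := by
      rw [Matrix.mulVec_mulVec, hR, ← Matrix.mulVec_mulVec, hfix]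
    rw [← hPa2] at hRa
    rw [hA, Matrix.mulVec_smul, hRa]
  refine ⟨actA x (y • a) ψ, hψ.actA hn, by rw [blochA_actA, hRa], blochB_actA hn, ?_⟩
  rw [corr_actA, hC, ← Matrix.mul_assoc, ← Matrix.mul_assoc, hR]
  congr 1
  rw [Matrix.mul_assoc]
  congr 1
  rw [hc, hd]
  have hy : (2 * y ^ 2) = 1 - (p * p₀ + q * q₀) / (1 - μ ^ 2) := by rw [← hc]; linarith
  rw [hy]
  ext i j
  fin_cases i <;> fin_cases j <;>
    simp [circleMat, quarterTurn, Matrix.mul_apply, Fin.sum_univ_three, Matrix.vecMulVec_apply,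
      Matrix.one_apply] <;> field_simp
  · linear_combination p * h₀
  · linear_combination q * h₀
  · linear_combination q * h₀
  · linear_combination (-p) * h₀

/-- The sum of squares is (u² + v²)(u'² + v'²) = (1 - w²)(1 - w'²), which falls short of (1 -
|ww'|)² by (|w| - |w'|)². -/
theorem frame_bound {u v w u' v' w' : ℝ} (h : u ^ 2 + v ^ 2 + w ^ 2 = 1)
    (h' : u' ^ 2 + v' ^ 2 + w' ^ 2 = 1) :
    |w * w'| ≤ 1 ∧ (u * u' - v * v') ^ 2 + (u * v' + v * u') ^ 2 ≤ (1 - |w * w'|) ^ 2 := by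
  have hw : |w| ^ 2 ≤ 1 := by rw [sq_abs]; nlinarith [sq_nonneg u, sq_nonneg v]
  have hw' : |w'| ^ 2 ≤ 1 := by rw [sq_abs]; nlinarith [sq_nonneg u', sq_nonneg v']
  rw [abs_mul]
  constructor
  · nlinarith [abs_nonneg w, abs_nonneg w', sq_nonneg (|w| - |w'|)]
  · have e : (u * u' - v * v') ^ 2 + (u * v' + v * u') ^ 2 = (1 - |w| ^ 2) * (1 - |w'| ^ 2) := by
      rw [sq_abs, sq_abs]
      linear_combination (u' ^ 2 + v' ^ 2) * h + (1 - w ^ 2) * h'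
    rw [e]
    nlinarith [sq_nonneg (|w| - |w'|)]

/-- The pure states with prescribed partially mixed local Bloch vectors form a circle. -/
theorem exists_circle (hψ : IsPureState ψ) (h0 : 0 < blochA ψ ⬝ᵥ blochA ψ)
    (h1 : blochA ψ ⬝ᵥ blochA ψ < 1) :
    ∃ m G H : Fin 9 → ℝ, (∀ k, |m k| ≤ 1 ∧ G k ^ 2 + H k ^ 2 ≤ (1 - |m k|) ^ 2) ∧
      (∀ φ, IsPureState φ → blochA φ = blochA ψ → blochB φ = blochB ψ →
        ∃ p q, p ^ 2 + q ^ 2 = 1 - blochA ψ ⬝ᵥ blochA ψ ∧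
          ∀ k, bloch φ (k.natAdd 7) = m k + p * G k + q * H k) ∧
      (∀ p q, p ^ 2 + q ^ 2 = 1 - blochA ψ ⬝ᵥ blochA ψ →
        ∃ φ, IsPureState φ ∧ blochA φ = blochA ψ ∧ blochB φ = blochB ψ ∧
          ∀ k, bloch φ (k.natAdd 7) = m k + p * G k + q * H k) := by
  obtain ⟨μ, hμ0, hμ⟩ : ∃ μ : ℝ, 0 < μ ∧ μ ^ 2 = blochA ψ ⬝ᵥ blochA ψ :=
    ⟨_, Real.sqrt_pos.2 h0, Real.sq_sqrt h0.le⟩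
  have hμ' : μ ^ 2 = blochB ψ ⬝ᵥ blochB ψ := by rw [hμ, blochA_dot_eq_blochB_dot]
  set a := μ⁻¹ • blochA ψ with ha_def
  set b := μ⁻¹ • blochB ψ with hb_def
  have hA : blochA ψ = μ • a := by rw [ha_def, smul_smul, mul_inv_cancel₀ hμ0.ne', one_smul]
  have hB : blochB ψ = μ • b := by rw [hb_def, smul_smul, mul_inv_cancel₀ hμ0.ne', one_smul]
  have ha : a ⬝ᵥ a = 1 := by
    rw [ha_def, smul_dotProduct, dotProduct_smul, ← hμ, smul_eq_mul, smul_eq_mul]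
    field_simp
  have hb : b ⬝ᵥ b = 1 := by
    rw [hb_def, smul_dotProduct, dotProduct_smul, ← hμ', smul_eq_mul, smul_eq_mul]
    field_simp
  obtain ⟨P, hP, hP', hPa, hPc⟩ := exists_frame ha
  obtain ⟨Q, hQ, -, hQb, hQc⟩ := exists_frame hb
  have row (R : Matrix (Fin 3) (Fin 3) ℝ) (hR : R * Rᵀ = 1) (i : Fin 3) :
      R i 0 ^ 2 + R i 1 ^ 2 + R i 2 ^ 2 = 1 := by
    have := congrFun (congrFun hR i) i
    simpa [Matrix.mul_apply, Fin.sum_univ_three, sq] using this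
  choose r c hrc using bloch_natAdd_eq_corr
  rw [← hμ] at h1 ⊢
  refine ⟨fun k => P (r k) 2 * Q (c k) 2,
    fun k => P (r k) 0 * Q (c k) 0 - P (r k) 1 * Q (c k) 1,
    fun k => P (r k) 0 * Q (c k) 1 + P (r k) 1 * Q (c k) 0,
    fun k => frame_bound (row P hP _) (row Q hQ _), ?_, ?_⟩
  · intro φ hφ hφA hφB
    obtain ⟨p, q, hpq, hC⟩ := corr_eq_circleMat hφ hμ0.ne' ha (hφA.trans hA) (hφB.trans hB)
      hP hP' hPa hPc hQ hQb hQc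
    exact ⟨p, q, hpq, fun k => by rw [hrc, hC, frame_circleMat_apply]⟩
  · intro p q hpq
    obtain ⟨p₀, q₀, hpq₀, hC₀⟩ := corr_eq_circleMat hψ hμ0.ne' ha hA hB
      hP hP' hPa hPc hQ hQb hQc
    obtain ⟨φ, hφ, hφA, hφB, hC⟩ := exists_corr_eq_circleMat hψ ha hA h1 hPa hP' hPc hpq₀ hC₀ hpq
    exact ⟨φ, hφ, hφA, hφB, fun k => by rw [hrc, hC, frame_circleMat_apply]⟩

end family

/-! ### Affine functions on a circle and their fibers -/

section circle

/-- A line meets the circle in at most two points, mirror images in the axis along (g, h): the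
components perpendicular to (g, h) have equal squares. -/
theorem eq_or_eq_reflection {S p₀ q₀ p q g h : ℝ} (hg : g ≠ 0 ∨ h ≠ 0)
    (h₀ : p₀ ^ 2 + q₀ ^ 2 = S) (h₁ : p ^ 2 + q ^ 2 = S)
    (hL : p * g + q * h = p₀ * g + q₀ * h) :
    (p = p₀ ∧ q = q₀) ∨
      (p = 2 * (p₀ * g + q₀ * h) * g / (g ^ 2 + h ^ 2) - p₀ ∧
        q = 2 * (p₀ * g + q₀ * h) * h / (g ^ 2 + h ^ 2) - q₀) := by
  have hn : g ^ 2 + h ^ 2 ≠ 0 := by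
    rcases hg with hg | hg <;> positivity
  have hsq : (p * h - q * g - (p₀ * h - q₀ * g)) * (p * h - q * g + (p₀ * h - q₀ * g)) = 0 := by
    linear_combination (g ^ 2 + h ^ 2) * (h₁ - h₀) -
      (p * g + q * h + (p₀ * g + q₀ * h)) * hL
  rcases mul_eq_zero.1 hsq with e | e
  · left
    constructor
    · refine mul_left_cancel₀ hn ?_
      linear_combination g * hL + h * e
    · refine mul_left_cancel₀ hn ?_
      linear_combination h * hL - g * e
  · right
    constructor <;> field_simp
    · linear_combination g * hL + h * e
    · linear_combination h * hL - g * e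

variable {n : ℕ} (m G H : Fin n → ℝ)

/-- The value of component `k` at the point `z` of the plane. -/
def circleVal (k : Fin n) (z : ℝ × ℝ) : ℝ := m k + z.1 * G k + z.2 * H k

/-- The points of the circle with squared radius `S` that share the components before the `k`-th
with `z₀`. -/
def circleFiber (S : ℝ) (z₀ : ℝ × ℝ) (k : Fin n) : Set (ℝ × ℝ) :=
  {z | z.1 ^ 2 + z.2 ^ 2 = S ∧ ∀ j < k, circleVal m G H j z = circleVal m G H j z₀}

variable {m G H} {S : ℝ} {z₀ : ℝ × ℝ} {k : Fin n}

/-- If an earlier function is nonconstant, the fiber is contained in {z₀, z₁} with z₁ the mirror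
image of z₀; otherwise it is the whole circle, symmetric under z ↦ -z. -/
theorem exists_circleFiber_symm (h₀ : z₀.1 ^ 2 + z₀.2 ^ 2 = S) :
    ∃ h, ∀ x ∈ circleVal m G H k '' circleFiber m G H S z₀ k,
      2 * h - x ∈ circleVal m G H k '' circleFiber m G H S z₀ k := by
  have hz₀ : z₀ ∈ circleFiber m G H S z₀ k := ⟨h₀, fun _ _ => rfl⟩
  by_cases hj : ∃ j < k, G j ≠ 0 ∨ H j ≠ 0
  · obtain ⟨j, hjk, hGH⟩ := hj
    set z₁ : ℝ × ℝ :=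
      (2 * (z₀.1 * G j + z₀.2 * H j) * G j / (G j ^ 2 + H j ^ 2) - z₀.1,
        2 * (z₀.1 * G j + z₀.2 * H j) * H j / (G j ^ 2 + H j ^ 2) - z₀.2)
    have key : ∀ z ∈ circleFiber m G H S z₀ k, z = z₀ ∨ z = z₁ := by
      rintro z ⟨hz, hzj⟩
      have := hzj j hjk
      simp only [circleVal] at this
      rcases eq_or_eq_reflection (p := z.1) (q := z.2) hGH h₀ hz (by linarith) with e | e
      · exact Or.inl (Prod.ext e.1 e.2)
      · exact Or.inr (Prod.ext e.1 e.2)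
    by_cases hz₁ : z₁ ∈ circleFiber m G H S z₀ k
    · refine ⟨(circleVal m G H k z₀ + circleVal m G H k z₁) / 2, ?_⟩
      rintro x ⟨z, hz, rfl⟩
      rcases key z hz with rfl | rfl
      · exact ⟨z₁, hz₁, by ring⟩
      · exact ⟨z₀, hz₀, by ring⟩
    · refine ⟨circleVal m G H k z₀, ?_⟩
      rintro x ⟨z, hz, rfl⟩
      rcases key z hz with rfl | rfl
      · exact ⟨z, hz, by ring⟩
      · exact absurd hz hz₁
  · push Not at hj
    refine ⟨m k, ?_⟩
    rintro x ⟨z, ⟨hz, hzj⟩, rfl⟩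
    refine ⟨-z, ⟨by simpa using hz, fun j hjk => ?_⟩, ?_⟩
    · simp [circleVal, hj j hjk]
    · simp [circleVal]
      ring

/-- After a split at i only the mirror image of z₀ can differ from z₀, so the witnesses at j and k
coincide. But the witness at k agrees with z₀ in component j, and the one at j does not. -/
theorem not_three_split (h₀ : z₀.1 ^ 2 + z₀.2 ^ 2 = S) {i j k : Fin n} (hij : i < j) (hjk : j < k)
    (hi : ∃ z ∈ circleFiber m G H S z₀ i, circleVal m G H i z ≠ circleVal m G H i z₀)
    (hj : ∃ z ∈ circleFiber m G H S z₀ j, circleVal m G H j z ≠ circleVal m G H j z₀)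
    (hk : ∃ z ∈ circleFiber m G H S z₀ k, circleVal m G H k z ≠ circleVal m G H k z₀) :
    False := by
  obtain ⟨x, -, hx⟩ := hi
  obtain ⟨y, ⟨hy, hyj⟩, hy'⟩ := hj
  obtain ⟨z, ⟨hz, hzj⟩, hz'⟩ := hk
  have hg : G i ≠ 0 ∨ H i ≠ 0 := by
    by_contra! h
    exact hx (by simp [circleVal, h.1, h.2])
  have h1 := hyj i hij
  have h2 := hzj i (hij.trans hjk)
  have h3 := hzj j hjk
  simp only [circleVal] at h1 h2
  rcases eq_or_eq_reflection (p := y.1) (q := y.2) hg h₀ hy (by linarith) with e | e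
  · exact hy' (by rw [Prod.ext (x := y) (y := z₀) e.1 e.2])
  rcases eq_or_eq_reflection (p := z.1) (q := z.2) hg h₀ hz (by linarith) with e' | e'
  · exact hz' (by rw [Prod.ext (x := z) (y := z₀) e'.1 e'.2])
  have hyz : y = z := Prod.ext (e.1.trans e'.1.symm) (e.2.trans e'.2.symm)
  exact hy' (hyz ▸ h3)

theorem sq_circleVal_sub_le (hG : G k ^ 2 + H k ^ 2 ≤ (1 - |m k|) ^ 2)
    {z : ℝ × ℝ} (h : z.1 ^ 2 + z.2 ^ 2 = S) :
    (circleVal m G H k z - m k) ^ 2 ≤ S * (1 - |m k|) ^ 2 := by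
  have hS : 0 ≤ S := h ▸ by positivity
  have := mul_le_mul_of_nonneg_left hG hS
  simp only [circleVal]
  nlinarith [sq_nonneg (z.1 * H k - z.2 * G k)]

/-- Equality would make z₀ parallel to (G i, H i). The level line is then tangent, the mirror image
of z₀ is z₀ itself, and nothing is left to split at j. -/
theorem sq_circleVal_sub_lt (h₀ : z₀.1 ^ 2 + z₀.2 ^ 2 = S)
    {i j : Fin n} (hG : G i ^ 2 + H i ^ 2 ≤ (1 - |m i|) ^ 2) (hij : i < j)
    (hi : ∃ z ∈ circleFiber m G H S z₀ i, circleVal m G H i z ≠ circleVal m G H i z₀)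
    (hj : ∃ z ∈ circleFiber m G H S z₀ j, circleVal m G H j z ≠ circleVal m G H j z₀) :
    (circleVal m G H i z₀ - m i) ^ 2 < S * (1 - |m i|) ^ 2 := by
  obtain ⟨x, -, hx⟩ := hi
  obtain ⟨y, ⟨hy, hyj⟩, hy'⟩ := hj
  have hg : G i ≠ 0 ∨ H i ≠ 0 := by
    by_contra! h
    exact hx (by simp [circleVal, h.1, h.2])
  have hn : G i ^ 2 + H i ^ 2 ≠ 0 := by
    rcases hg with hg | hg <;> positivity
  have h1 := hyj i hij
  have hS : 0 ≤ S := h₀ ▸ by positivity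
  have hS' := mul_le_mul_of_nonneg_left hG hS
  simp only [circleVal] at h1 ⊢
  by_contra! hle
  have e : z₀.1 * H i - z₀.2 * G i = 0 := by
    have : (z₀.1 * H i - z₀.2 * G i) ^ 2 = 0 := by
      refine le_antisymm ?_ (sq_nonneg _)
      nlinarith
    simpa using this
  refine hy' ?_
  rcases eq_or_eq_reflection (p := y.1) (q := y.2) hg h₀ hy (by linarith) with c | c
  · rw [Prod.ext (x := y) (y := z₀) c.1 c.2]
  · have c1 : y.1 = z₀.1 := by
      rw [c.1]
      field_simp
      linear_combination (-2) * H i * e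
    have c2 : y.2 = z₀.2 := by
      rw [c.2]
      field_simp
      linear_combination 2 * G i * e
    rw [Prod.ext (x := y) (y := z₀) c1 c2]

end circle

/-! ### Bounding the contributions on the circle -/

section bounds

theorem abs_le_of_sq_le_mul {S t x s : ℝ} (hs : s ^ 2 = S) (hs0 : 0 < s) (ht : 0 ≤ t)
    (h : x ^ 2 ≤ S * t ^ 2) : |x| ≤ s * t := by
  refine abs_le_of_sq_le_sq ?_ (by positivity)
  rw [mul_pow, hs]
  exact h

/-- A component whose feasible set is symmetric about `h` contributes at most `S` if its feasible
values stay within `√S (1 - |m|)` of `m`. -/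
theorem chiSq_le_of_sq_le {S m b h : ℝ} (hS : 0 < S) (hS1 : S ≤ 1) (hm : |m| ≤ 1)
    (hb : (b - m) ^ 2 ≤ S * (1 - |m|) ^ 2) (hb' : (2 * h - b - m) ^ 2 ≤ S * (1 - |m|) ^ 2) :
    chiSq b h ≤ S ∧ ((b - m) ^ 2 < S * (1 - |m|) ^ 2 → chiSq b h < S) := by
  obtain ⟨s, hs0, hs⟩ : ∃ s : ℝ, 0 < s ∧ s ^ 2 = S := ⟨_, Real.sqrt_pos.2 hS, Real.sq_sqrt hS.le⟩
  have hs1 : s ≤ 1 := by nlinarith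
  have ht : 0 ≤ 1 - |m| := by linarith
  have h1 := abs_le.1 (abs_le_of_sq_le_mul hs hs0 ht hb)
  have h2 := abs_le.1 (abs_le_of_sq_le_mul hs hs0 ht hb')
  -- Both b and its mirror image 2h - b lie in the interval of radius s(1 - |m|) about m. With |b -
  -- h| = sv this yields |h| ≤ 1 - v, hence 1 - h² ≥ v and a divergence of at most Sv.
  have h3 : |h - m| + |b - h| ≤ s * (1 - |m|) := by
    rcases abs_cases (h - m) with e | e <;> rcases abs_cases (b - h) with e' | e' <;> linarith
  by_cases hV : b = h
  · rw [hV, chiSq_self]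
    exact ⟨hS.le, fun _ => hS⟩
  have hV0 : 0 < |b - h| := abs_pos.2 (sub_ne_zero.2 hV)
  obtain ⟨v, hv⟩ : ∃ v, |b - h| = s * v := ⟨|b - h| / s, by field_simp⟩
  have hv0 : 0 < v := by
    rw [hv] at hV0
    exact pos_of_mul_pos_right hV0 hs0.le
  have hvt : v ≤ 1 - |m| := by
    have : s * v ≤ s * (1 - |m|) := by linarith [abs_nonneg (h - m)]
    exact le_of_mul_le_mul_left this hs0
  have hh : |h| ≤ 1 - v := by
    have e1 : |h| ≤ |m| + |h - m| := by
      have := abs_add_le m (h - m)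
      simpa using this
    have e2 : s * (1 - |m| - v) ≤ 1 * (1 - |m| - v) :=
      mul_le_mul_of_nonneg_right hs1 (by linarith)
    linarith
  have hh1 : h ^ 2 ≤ |h| := by
    rw [← sq_abs]
    nlinarith [abs_nonneg h]
  have hhv : v ≤ 1 - h ^ 2 := by linarith
  have hv1 : v ≤ 1 := by linarith [abs_nonneg m]
  have hsq : (b - h) ^ 2 = S * v ^ 2 := by rw [← sq_abs, hv, mul_pow, hs]
  rw [chiSq_eq (by linarith), hsq, div_le_iff₀ (by linarith), div_lt_iff₀ (by linarith)]
  constructor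
  · refine mul_le_mul_of_nonneg_left ?_ hS.le
    nlinarith
  · intro hlt
    refine mul_lt_mul_of_pos_left ?_ hS
    -- v = 1 would force m = 0 and h = m, so b would be at distance s from m, against strictness.
    have hv1' : v < 1 := by
      refine lt_of_le_of_ne hv1 fun e => ?_
      rw [e] at hvt hv
      have hm0 : |m| = 0 := by linarith [abs_nonneg m]
      rw [hm0] at h3 hlt
      have hU : h - m = 0 := abs_eq_zero.1 (by linarith [abs_nonneg (h - m)])
      have : b - m = b - h := by linarith
      rw [this, hsq, e] at hlt
      linarith
    nlinarith

/-- At most two terms survive. With two of them strictness comes from the earlier one; with fewer, S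
< 2S suffices. -/
theorem sum_lt_of_split {n : ℕ} {S : ℝ} (hS : 0 < S) (f : Fin n → ℝ) (P : Fin n → Prop)
    (hf : ∀ k, f k ≤ S) (h0 : ∀ k, ¬ P k → f k = 0)
    (h3 : ∀ i j k, i < j → j < k → P i → P j → P k → False)
    (h2 : ∀ i j, i < j → P i → P j → f i < S) : ∑ k, f k < 2 * S := by
  by_cases h : ∃ i j, i < j ∧ P i ∧ P j
  · obtain ⟨i, j, hij, hi, hj⟩ := h
    have : ∑ k, f k = ∑ k ∈ {i, j}, f k := by
      refine (Finset.sum_subset (Finset.subset_univ _) fun k _ hk => h0 k fun hPk => ?_).symm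
      simp only [Finset.mem_insert, Finset.mem_singleton, not_or] at hk
      rcases lt_or_gt_of_ne hk.1 with h | h
      · exact h3 k i j h hij hPk hi hj
      rcases lt_or_gt_of_ne hk.2 with h' | h'
      · exact h3 i k j h h' hi hPk hj
      · exact h3 i j k hij h' hi hj hPk
    rw [this, Finset.sum_pair hij.ne]
    linarith [h2 i j hij hi hj, hf j]
  · push Not at h
    by_cases hi : ∃ i, P i
    · obtain ⟨i, hi⟩ := hi
      rw [Finset.sum_eq_single i]
      · linarith [hf i]
      · intro k _ hk
        refine h0 k fun hPk => ?_
        rcases lt_or_gt_of_ne hk with h' | h'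
        · exact h k i h' hPk hi
        · exact h i k h' hi hPk
      · simp
    · push Not at hi
      rw [Finset.sum_eq_zero fun k _ => h0 k (hi k)]
      linarith

end bounds

theorem postInfo_lt_two {ψ : TwoQubit} (hψ : IsPureState ψ) (h0 : 0 < blochA ψ ⬝ᵥ blochA ψ)
    (h1 : blochA ψ ⬝ᵥ blochA ψ < 1) : postInfo ψ < 2 := by
  obtain ⟨m, G, H, hb, hc, hc'⟩ := exists_circle hψ h0 h1
  obtain ⟨p₀, q₀, h₀, hv⟩ := hc ψ hψ rfl rfl
  set S := 1 - blochA ψ ⬝ᵥ blochA ψ with hS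
  have hfeas (k : Fin 9) : feasible ψ (k.natAdd 7) =
      circleVal m G H k '' circleFiber m G H S (p₀, q₀) k := by
    ext x
    constructor
    · rintro ⟨φ, hφ, hj, rfl⟩
      obtain ⟨hA, hB⟩ := (bloch_lt_seven_iff hφ hψ).1 fun j hj' =>
        hj j (lt_of_lt_of_le hj' (Fin.le_def.2 (by simp)))
      obtain ⟨p, q, hpq, hv'⟩ := hc φ hφ hA hB
      refine ⟨(p, q), ⟨hpq, fun j hjk => ?_⟩, (hv' k).symm⟩
      have := hj (j.natAdd 7) ((Fin.natAdd_lt_natAdd_iff 7).2 hjk)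
      rwa [hv', hv] at this
    · rintro ⟨⟨p, q⟩, ⟨hpq, hj⟩, rfl⟩
      obtain ⟨φ, hφ, hA, hB, hv'⟩ := hc' p q hpq
      refine ⟨φ, hφ, fun j hjk => ?_, hv' k⟩
      by_cases hj7 : j < 7
      · exact (bloch_lt_seven_iff hφ hψ).2 ⟨hA, hB⟩ j hj7
      · obtain ⟨j', rfl⟩ : ∃ j' : Fin 9, j = j'.natAdd 7 :=
          ⟨⟨j - 7, by omega⟩, Fin.ext (by simp; omega)⟩
        rw [hv', hv]
        exact hj j' ((Fin.natAdd_lt_natAdd_iff 7).1 hjk)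
  have hval (k : Fin 9) : bloch ψ (k.natAdd 7) = circleVal m G H k (p₀, q₀) := hv k
  have hmid (k : Fin 9) : ∃ z : ℝ × ℝ, z.1 ^ 2 + z.2 ^ 2 = S ∧
      2 * blochMid ψ (k.natAdd 7) - bloch ψ (k.natAdd 7) = circleVal m G H k z := by
    obtain ⟨h, hh⟩ := exists_circleFiber_symm (m := m) (G := G) (H := H) (k := k)
      (z₀ := (p₀, q₀)) h₀
    rw [← hfeas] at hh
    rw [blochMid_eq_of_symm hψ hh]
    have := hh _ (bloch_mem_feasible hψ)
    rw [hfeas] at this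
    obtain ⟨z, hz, e⟩ := this
    exact ⟨z, hz.1, e.symm⟩
  have hterm (k : Fin 9) : infoTerm ψ (k.natAdd 7) ≤ S ∧
      ((bloch ψ (k.natAdd 7) - m k) ^ 2 < S * (1 - |m k|) ^ 2 →
        infoTerm ψ (k.natAdd 7) < S) := by
    obtain ⟨z, hz, e⟩ := hmid k
    refine chiSq_le_of_sq_le (by linarith) (by linarith) (hb k).1 ?_ ?_
    · rw [hval]
      exact sq_circleVal_sub_le (hb k).2 h₀
    · rw [e]
      exact sq_circleVal_sub_le (hb k).2 hz
  have hsum : ∑ k : Fin 9, infoTerm ψ (k.natAdd 7) < 2 * S := by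
    refine sum_lt_of_split (by linarith) _
      (fun k => ∃ z ∈ circleFiber m G H S (p₀, q₀) k,
        circleVal m G H k z ≠ circleVal m G H k (p₀, q₀))
      (fun k => (hterm k).1) (fun k hk => ?_)
      (fun i j k hij hjk hi hj hk => not_three_split h₀ hij hjk hi hj hk)
      (fun i j hij hi hj => (hterm i).2 ?_)
    · push Not at hk
      refine chiSq_bloch_eq_zero hψ fun φ hφ hj => ?_
      have : bloch φ (k.natAdd 7) ∈ feasible ψ (k.natAdd 7) := ⟨φ, hφ, hj, rfl⟩
      rw [hfeas] at this
      obtain ⟨z, hz, e⟩ := this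
      rw [← e, hk z hz, hval]
    · rw [hval]
      exact sq_circleVal_sub_lt h₀ (hb i).2 hij hi hj
  rw [postInfo_eq hψ]
  linarith

/-! ### Reflecting the first two rows of C when μ = 0 -/

section reflection

/-- The reflection along the unit vector `m`. -/
def reflectAlong (m v : Fin 3 → ℝ) : Fin 3 → ℝ := v - (2 * (m ⬝ᵥ v)) • m

variable {ψ : TwoQubit}

/-- A maximally entangled state can be transformed so that the first two rows of the correlation
matrix are reflected. -/
theorem exists_reflected {φ : TwoQubit} (hφ : IsPureState φ) (hA : blochA φ = 0)
    {m : Fin 3 → ℝ} (hm : m ⬝ᵥ m = 1) :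
    ∃ φ', IsPureState φ' ∧ blochA φ' = 0 ∧ corr φ' 0 = reflectAlong m (corr φ 0) ∧
      corr φ' 1 = reflectAlong m (corr φ 1) := by
  have hm' : (0 : ℝ) ^ 2 + m ⬝ᵥ m = 1 := by simp [hm]
  have he : (![0, 0, 1] : Fin 3 → ℝ) ⬝ᵥ ![0, 0, 1] = 1 := by simp
  have he' : (0 : ℝ) ^ 2 + (![0, 0, 1] : Fin 3 → ℝ) ⬝ᵥ ![0, 0, 1] = 1 := by simp
  -- The half-turn about e₃ on the first qubit negates the first two rows, and minus the half-turn
  -- about m is the reflection along m.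
  refine ⟨actA 0 ![0, 0, 1] (actB 0 m φ), (hφ.actB hm').actA he', ?_, ?_, ?_⟩
  · rw [blochA_actA, blochA_actB hm', hA, Matrix.mulVec_zero]
  · have h : corr (actA 0 ![0, 0, 1] (actB 0 m φ)) 0 = -corr (actB 0 m φ) 0 := by
      rw [corr_actA]
      ext j
      simp [Matrix.mul_apply, Fin.sum_univ_three, quatRot]
    rw [h, corr_actB_row]
    ext j
    simp [quatRot_mulVec_zero _ _ hm, reflectAlong]
  · have h : corr (actA 0 ![0, 0, 1] (actB 0 m φ)) 1 = -corr (actB 0 m φ) 1 := by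
      rw [corr_actA]
      ext j
      simp [Matrix.mul_apply, Fin.sum_univ_three, quatRot]
    rw [h, corr_actB_row]
    ext j
    simp [quatRot_mulVec_zero _ _ hm, reflectAlong]

theorem blochB_eq_zero (hA : blochA ψ = 0) : blochB ψ = 0 := by
  rw [← dotProduct_self_eq_zero, ← blochA_dot_eq_blochB_dot, hA, dotProduct_zero]

theorem blochMid_of_reflection (hψ : IsPureState ψ) (hA : blochA ψ = 0) {k : Fin 16} (hk : 7 ≤ k)
    {h : ℝ} (H : ∀ φ, IsPureState φ → blochA φ = 0 → (∀ j < k, bloch φ j = bloch ψ j) →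
      ∃ m : Fin 3 → ℝ, m ⬝ᵥ m = 1 ∧ ∀ φ', corr φ' 0 = reflectAlong m (corr φ 0) →
        corr φ' 1 = reflectAlong m (corr φ 1) →
        (∀ j, 7 ≤ j → j < k → bloch φ' j = bloch φ j) ∧ bloch φ' k = 2 * h - bloch φ k) :
    blochMid ψ k = h := by
  refine blochMid_eq_of_unitary hψ fun φ hφ hj => ?_
  obtain ⟨hφA, -⟩ := (bloch_lt_seven_iff hφ hψ).1 fun j hj' => hj j (lt_of_lt_of_le hj' hk)
  rw [hA] at hφA
  obtain ⟨m, hm, hm'⟩ := H φ hφ hφA hj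
  obtain ⟨φ', hφ', hφA', h0, h1⟩ := exists_reflected hφ hφA hm
  obtain ⟨e1, e2⟩ := hm' φ' h0 h1
  refine ⟨φ', hφ', fun j hjk => ?_, e2⟩
  by_cases hj7 : j < 7
  · exact (bloch_lt_seven_iff hφ' hφ).2
      ⟨hφA'.trans hφA.symm, (blochB_eq_zero hφA').trans (blochB_eq_zero hφA).symm⟩ j hj7
  · exact e1 j (not_lt.1 hj7) hjk

theorem IsPureState.corr_rows (hψ : IsPureState ψ) (hA : blochA ψ = 0) (i j : Fin 3) :
    corr ψ i 0 * corr ψ j 0 + corr ψ i 1 * corr ψ j 1 + corr ψ i 2 * corr ψ j 2 =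
      if i = j then 1 else 0 := by
  have := congrFun (congrFun hψ.corr_mul_transpose i) j
  simpa [hA, Matrix.mul_apply, Fin.sum_univ_three, Matrix.one_apply] using this

theorem IsPureState.corr_cols (hψ : IsPureState ψ) (hA : blochA ψ = 0) (i j : Fin 3) :
    corr ψ 0 i * corr ψ 0 j + corr ψ 1 i * corr ψ 1 j + corr ψ 2 i * corr ψ 2 j =
      if i = j then 1 else 0 := by
  have := congrFun (congrFun hψ.corr_transpose_mul i) j
  simpa [hA, blochB_eq_zero hA, Matrix.mul_apply, Fin.sum_univ_three, Matrix.one_apply] using this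

end reflection

/-! ### Maximally entangled states -/

section maxEntangled

variable {ψ : TwoQubit}

theorem blochMid_row_zero (hψ : IsPureState ψ) (hA : blochA ψ = 0) :
    blochMid ψ 7 = 0 ∧ blochMid ψ 8 = 0 ∧ blochMid ψ 9 = 0 := by
  refine ⟨blochMid_of_reflection hψ hA le_rfl fun φ _ _ _ =>
      ⟨![1, 0, 0], by simp, fun φ' h0 _ => ⟨fun j h1 h2 => absurd h1 (not_le.2 h2), ?_⟩⟩,
    blochMid_of_reflection hψ hA (by decide) fun φ _ _ _ =>
      ⟨![0, 1, 0], by simp, fun φ' h0 _ => ⟨fun j h1 h2 => ?_, ?_⟩⟩,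
    blochMid_of_reflection hψ hA (by decide) fun φ _ _ _ =>
      ⟨![0, 0, 1], by simp, fun φ' h0 _ => ⟨fun j h1 h2 => ?_, ?_⟩⟩⟩
  · change corr φ' 0 0 = 2 * 0 - corr φ 0 0
    simp [h0, reflectAlong, dotProduct, Fin.sum_univ_three]
    ring
  · obtain rfl : j = 7 := by omega
    change corr φ' 0 0 = corr φ 0 0
    simp [h0, reflectAlong]
  · change corr φ' 0 1 = 2 * 0 - corr φ 0 1
    simp [h0, reflectAlong, dotProduct, Fin.sum_univ_three]
    ring
  · have : j = 7 ∨ j = 8 := by omega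
    rcases this with rfl | rfl
    · change corr φ' 0 0 = corr φ 0 0
      simp [h0, reflectAlong]
    · change corr φ' 0 1 = corr φ 0 1
      simp [h0, reflectAlong]
  · change corr φ' 0 2 = 2 * 0 - corr φ 0 2
    simp [h0, reflectAlong, dotProduct, Fin.sum_univ_three]
    ring

/-- The first row of the correlation matrix is fixed by the components before `b₁₁`. -/
theorem corr_zero_of_agree {φ : TwoQubit} {k : Fin 16} (hk : 10 ≤ k)
    (h : ∀ j < k, bloch φ j = bloch ψ j) : corr φ 0 = corr ψ 0 := by
  have h7 := h 7 (lt_of_lt_of_le (by decide) hk)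
  have h8 := h 8 (lt_of_lt_of_le (by decide) hk)
  have h9 := h 9 (lt_of_lt_of_le (by decide) hk)
  ext j
  fin_cases j
  exacts [h7, h8, h9]

theorem bloch_seven_to_nine {φ φ' : TwoQubit} (h : corr φ' 0 = corr φ 0) {j : Fin 16}
    (h7 : 7 ≤ j) (hj : j < 10) : bloch φ' j = bloch φ j := by
  have : j = 7 ∨ j = 8 ∨ j = 9 := by omega
  rcases this with rfl | rfl | rfl
  exacts [congrFun h 0, congrFun h 1, congrFun h 2]

theorem reflectAlong_of_dot_eq_zero {m v : Fin 3 → ℝ} (h : m ⬝ᵥ v = 0) :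
    reflectAlong m v = v := by
  simp [reflectAlong, h]

/-- Reflecting along the second row negates it and fixes the first row, which is orthogonal to it.
-/
theorem blochMid_ten (hψ : IsPureState ψ) (hA : blochA ψ = 0) : blochMid ψ 10 = 0 := by
  refine blochMid_of_reflection hψ hA (by decide) fun φ hφ hφA _ =>
    ⟨corr φ 1, ?_, fun φ' h0 h1 => ⟨fun j h2 h3 => ?_, ?_⟩⟩
  · simpa [dotProduct, Fin.sum_univ_three] using hφ.corr_rows hφA 1 1
  · rw [reflectAlong_of_dot_eq_zero] at h0
    · exact bloch_seven_to_nine h0 h2 h3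
    · simpa [dotProduct, Fin.sum_univ_three] using hφ.corr_rows hφA 1 0
  · have e : corr φ 1 ⬝ᵥ corr φ 1 = 1 := by
      simpa [dotProduct, Fin.sum_univ_three] using hφ.corr_rows hφA 1 1
    change corr φ' 1 0 = 2 * 0 - corr φ 1 0
    rw [h1, reflectAlong, e]
    simp
    ring

theorem blochMid_eleven (hψ : IsPureState ψ) (hA : blochA ψ = 0)
    (hp : 0 < corr ψ 0 1 ^ 2 + corr ψ 0 2 ^ 2) :
    blochMid ψ 11 =
      -(corr ψ 0 0 * corr ψ 0 1 * corr ψ 1 0) / (corr ψ 0 1 ^ 2 + corr ψ 0 2 ^ 2) := by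
  refine blochMid_of_reflection hψ hA (by decide) fun φ hφ hφA hj => ?_
  have hr := corr_zero_of_agree (by decide) hj
  have h10 : corr φ 1 0 = corr ψ 1 0 := hj 10 (by decide)
  rw [← hr, ← h10]
  rw [← hr] at hp
  have hs := Real.sq_sqrt hp.le
  have hs0 := (Real.sqrt_pos.2 hp).ne'
  set s := √(corr φ 0 1 ^ 2 + corr φ 0 2 ^ 2)
  have horth := hφ.corr_rows hφA 0 1
  simp only [zero_ne_one, if_false] at horth
  -- This unit vector is orthogonal to the first row and to e₁, so the reflection preserves the
  -- first row and c₂₁.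
  refine ⟨![0, corr φ 0 2 / s, -corr φ 0 1 / s], ?_, fun φ' h0 h1 => ⟨fun j h2 h3 => ?_, ?_⟩⟩
  · simp [dotProduct, Fin.sum_univ_three]
    field_simp
    linarith
  · rw [reflectAlong_of_dot_eq_zero] at h0
    · by_cases h10 : j < 10
      · exact bloch_seven_to_nine h0 h2 h10
      · obtain rfl : j = 10 := by omega
        change corr φ' 1 0 = corr φ 1 0
        simp [h1, reflectAlong]
    · simp [dotProduct, Fin.sum_univ_three]
      ring
  · change corr φ' 1 1 = 2 * _ - corr φ 1 1
    rw [h1, ← hs]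
    simp [reflectAlong, dotProduct, Fin.sum_univ_three]
    field_simp
    rw [hs]
    linear_combination 2 * corr φ 0 1 * horth

/-- The unit first column forces c₂₁ = 0, so negating the whole second row preserves all earlier
components. -/
theorem blochMid_eleven_of_sq_eq_one (hψ : IsPureState ψ) (hA : blochA ψ = 0)
    (hp : corr ψ 0 0 ^ 2 = 1) : blochMid ψ 11 = 0 := by
  refine blochMid_of_reflection hψ hA (by decide) fun φ hφ hφA hj =>
    ⟨corr φ 1, ?_, fun φ' h0 h1 => ?_⟩
  · simpa [dotProduct, Fin.sum_univ_three] using hφ.corr_rows hφA 1 1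
  · have e : corr φ 1 ⬝ᵥ corr φ 1 = 1 := by
      simpa [dotProduct, Fin.sum_univ_three] using hφ.corr_rows hφA 1 1
    have hneg : corr φ' 1 = - corr φ 1 := by
      rw [h1, reflectAlong, e]
      module
    have hr := corr_zero_of_agree (by decide) hj
    have hc := hφ.corr_cols hφA 0 0
    simp only [if_true] at hc
    rw [← hr] at hp
    have h10 : corr φ 1 0 = 0 := by
      nlinarith [sq_nonneg (corr φ 1 0), sq_nonneg (corr φ 2 0)]
    rw [reflectAlong_of_dot_eq_zero] at h0
    · refine ⟨fun j h2 h3 => ?_, ?_⟩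
      · by_cases hj10 : j < 10
        · exact bloch_seven_to_nine h0 h2 hj10
        · obtain rfl : j = 10 := by omega
          change corr φ' 1 0 = corr φ 1 0
          simp [hneg, h10]
      · change corr φ' 1 1 = 2 * 0 - corr φ 1 1
        simp [hneg]
    · simpa [dotProduct, Fin.sum_univ_three] using hφ.corr_rows hφA 1 0

theorem blochMid_twelve_of_eq_zero (hψ : IsPureState ψ) (hA : blochA ψ = 0)
    (hp : corr ψ 0 2 = 0) : blochMid ψ 12 = 0 := by
  refine blochMid_of_reflection hψ hA (by decide) fun φ hφ hφA hj =>
    ⟨![0, 0, 1], by simp, fun φ' h0 h1 => ?_⟩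
  have hr := corr_zero_of_agree (by decide) hj
  rw [← hr] at hp
  rw [reflectAlong_of_dot_eq_zero (by simp [dotProduct, Fin.sum_univ_three, hp])] at h0
  refine ⟨fun j h2 h3 => ?_, ?_⟩
  · by_cases hj10 : j < 10
    · exact bloch_seven_to_nine h0 h2 hj10
    · have : j = 10 ∨ j = 11 := by omega
      rcases this with rfl | rfl
      · change corr φ' 1 0 = corr φ 1 0
        simp [h1, reflectAlong]
      · change corr φ' 1 1 = corr φ 1 1
        simp [h1, reflectAlong]
  · change corr φ' 1 2 = 2 * 0 - corr φ 1 2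
    simp [h1, reflectAlong, dotProduct, Fin.sum_univ_three]
    ring

/-- Orthogonality of the first two rows is a linear equation for c₂₃ with coefficient c₁₃ ≠ 0. -/
theorem infoTerm_twelve_of_ne_zero (hψ : IsPureState ψ) (hA : blochA ψ = 0)
    (hp : corr ψ 0 2 ≠ 0) : infoTerm ψ 12 = 0 := by
  refine chiSq_bloch_eq_zero hψ fun φ hφ hj => ?_
  obtain ⟨hφA, -⟩ := (bloch_lt_seven_iff hφ hψ).1 fun j hj' => hj j (hj'.trans (by decide))
  have hr := corr_zero_of_agree (by decide) hj
  have h10 : corr φ 1 0 = corr ψ 1 0 := hj 10 (by decide)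
  have h11 : corr φ 1 1 = corr ψ 1 1 := hj 11 (by decide)
  have e1 := hψ.corr_rows hA 0 1
  have e2 := hφ.corr_rows (hφA.trans hA) 0 1
  rw [hr, h10, h11] at e2
  change corr φ 1 2 = corr ψ 1 2
  refine mul_left_cancel₀ hp ?_
  linarith

theorem infoTerm_row_two (hψ : IsPureState ψ) (hA : blochA ψ = 0) :
    infoTerm ψ 13 = 0 ∧ infoTerm ψ 14 = 0 ∧ infoTerm ψ 15 = 0 := by
  have key : ∀ k : Fin 16, 13 ≤ k → ∀ φ, IsPureState φ → (∀ j < k, bloch φ j = bloch ψ j) →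
      corr φ 2 = corr ψ 2 := by
    intro k hk φ hφ hj
    obtain ⟨hφA, -⟩ := (bloch_lt_seven_iff hφ hψ).1 fun j hj' =>
      hj j (lt_of_lt_of_le (hj'.trans (by decide)) hk)
    have h0 := corr_zero_of_agree (le_trans (by decide) hk) hj
    have h1 : corr φ 1 = corr ψ 1 := by
      ext i
      fin_cases i
      exacts [hj 10 (lt_of_lt_of_le (by decide) hk), hj 11 (lt_of_lt_of_le (by decide) hk),
        hj 12 (lt_of_lt_of_le (by decide) hk)]
    -- With α = 0 the last row is minus the cross product of the first two.
    have e1 := hψ.cross_rows_corr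
    have e2 := hφ.cross_rows_corr
    rw [h0, h1, hφA, hA, blochB_eq_zero (hφA.trans hA)] at e2
    rw [hA, blochB_eq_zero hA, e2] at e1
    simpa using e1
  refine ⟨chiSq_bloch_eq_zero hψ fun φ hφ hj => congrFun (key _ (by decide) φ hφ hj) 0,
    chiSq_bloch_eq_zero hψ fun φ hφ hj => congrFun (key _ (by decide) φ hφ hj) 1,
    chiSq_bloch_eq_zero hψ fun φ hφ hj => congrFun (key _ (by decide) φ hφ hj) 2⟩

theorem postInfo_maxEntangled (hψ : IsPureState ψ) (hA : blochA ψ = 0) :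
    postInfo ψ = 1 + corr ψ 1 0 ^ 2 + infoTerm ψ 11 + infoTerm ψ 12 := by
  obtain ⟨m7, m8, m9⟩ := blochMid_row_zero hψ hA
  obtain ⟨t13, t14, t15⟩ := infoTerm_row_two hψ hA
  have t7 : infoTerm ψ 7 = corr ψ 0 0 ^ 2 := by rw [infoTerm, m7, chiSq_zero]; rfl
  have t8 : infoTerm ψ 8 = corr ψ 0 1 ^ 2 := by rw [infoTerm, m8, chiSq_zero]; rfl
  have t9 : infoTerm ψ 9 = corr ψ 0 2 ^ 2 := by rw [infoTerm, m9, chiSq_zero]; rfl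
  have t10 : infoTerm ψ 10 = corr ψ 1 0 ^ 2 := by
    rw [infoTerm, blochMid_ten hψ hA, chiSq_zero]; rfl
  have e (f : Fin 16 → ℝ) : ∑ k : Fin 9, f (k.natAdd 7) =
      f 7 + f 8 + f 9 + f 10 + f 11 + f 12 + f 13 + f 14 + f 15 := by
    simp only [Fin.sum_univ_succ, Fin.sum_univ_zero]
    simp only [add_zero, ← add_assoc]
    rfl
  have h := hψ.corr_rows hA 0 0
  simp only [if_true] at h
  rw [postInfo_eq hψ, hA, e, t7, t8, t9, t10, t13, t14, t15, dotProduct_zero]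
  linear_combination h

/-- The real inequality behind the maximally entangled case, with `u = c₁₂²`, `v = c₁₃²`,
`x = c₂₁²`. -/
theorem maxEntangled_ineq {u v x : ℝ} (hu : 0 ≤ u) (hv : 0 < v) (hp : u + v ≤ 1) (hx : 0 ≤ x)
    (hxp : x ≤ u + v) :
    0 < (u + v) ^ 2 - (1 - (u + v)) * u * x ∧
      v * (u + v - x) / ((u + v) ^ 2 - (1 - (u + v)) * u * x) ≤ 1 - x ∧
      (v * (u + v - x) / ((u + v) ^ 2 - (1 - (u + v)) * u * x) = 1 - x ↔
        (1 - (u + v)) * x = 0 ∧ u * (u + v - x) = 0) := by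
  have hd : 0 < (u + v) ^ 2 - (1 - (u + v)) * u * x := by
    have h1 : u * x ≤ (u + v) * (u + v) :=
      mul_le_mul (by linarith) hxp hx (by linarith)
    have h2 : (1 - (u + v)) * (u * x) ≤ (1 - (u + v)) * ((u + v) * (u + v)) :=
      mul_le_mul_of_nonneg_left h1 (by linarith)
    have h3 : 0 < (u + v) ^ 3 := by positivity
    nlinarith
  have hw : 0 < u + v - u * (1 - x) := by nlinarith
  have h1 : 0 ≤ (1 - (u + v)) * x * (u + v - u * (1 - x)) :=
    mul_nonneg (mul_nonneg (by linarith) hx) hw.le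
  have h2 : 0 ≤ u * (u + v - x) := mul_nonneg hu (by linarith)
  -- The defect, cleared of its denominator, as a sum of two nonnegative products; equality holds
  -- when both vanish.
  have key : (1 - x) * ((u + v) ^ 2 - (1 - (u + v)) * u * x) - v * (u + v - x) =
      (1 - (u + v)) * x * (u + v - u * (1 - x)) + u * (u + v - x) := by ring
  refine ⟨hd, ?_, ?_⟩
  · rw [div_le_iff₀ hd]
    linarith
  · rw [div_eq_iff hd.ne']
    constructor
    · intro h
      have e1 : (1 - (u + v)) * x * (u + v - u * (1 - x)) = 0 := by linarith
      exact ⟨(mul_eq_zero.1 e1).resolve_right hw.ne', by linarith⟩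
    · rintro ⟨e1, e2⟩
      rw [e1, e2] at key
      linarith

/-- The bracket is, up to sign, the first coordinate of the cross product of the first two rows. Its
square measures how far c₂₁² is from its largest possible value. -/
theorem sq_dot_cross_rows_corr (hψ : IsPureState ψ) (hA : blochA ψ = 0) :
    (corr ψ 0 2 * corr ψ 1 1 - corr ψ 0 1 * corr ψ 1 2) ^ 2 =
        corr ψ 0 1 ^ 2 + corr ψ 0 2 ^ 2 - corr ψ 1 0 ^ 2 := by
  have r00 := hψ.corr_rows hA 0 0
  have r11 := hψ.corr_rows hA 1 1
  have r01 := hψ.corr_rows hA 0 1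
  simp only [if_true, zero_ne_one, if_false, ← sq] at r00 r11 r01
  linear_combination (corr ψ 0 1 ^ 2 + corr ψ 0 2 ^ 2) * r11 -
        (corr ψ 0 1 * corr ψ 1 1 + corr ψ 0 2 * corr ψ 1 2 - corr ψ 0 0 * corr ψ 1 0) * r01 -
        corr ψ 1 0 ^ 2 * r00

theorem sq_corr_one_zero_le (hψ : IsPureState ψ) (hA : blochA ψ = 0) :
    corr ψ 1 0 ^ 2 ≤ corr ψ 0 1 ^ 2 + corr ψ 0 2 ^ 2 := by
  have := sq_dot_cross_rows_corr hψ hA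
  have := sq_nonneg (corr ψ 0 2 * corr ψ 1 1 - corr ψ 0 1 * corr ψ 1 2)
  linarith

theorem infoTerm_eleven (hψ : IsPureState ψ) (hA : blochA ψ = 0) (h02 : corr ψ 0 2 ≠ 0) :
    infoTerm ψ 11 = corr ψ 0 2 ^ 2 *
        (corr ψ 0 1 ^ 2 + corr ψ 0 2 ^ 2 - corr ψ 1 0 ^ 2) /
        ((corr ψ 0 1 ^ 2 + corr ψ 0 2 ^ 2) ^ 2 -
        (1 - (corr ψ 0 1 ^ 2 + corr ψ 0 2 ^ 2)) * corr ψ 0 1 ^ 2 * corr ψ 1 0 ^ 2) := by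
  have r00 := hψ.corr_rows hA 0 0
  have r01 := hψ.corr_rows hA 0 1
  simp only [if_true, zero_ne_one, if_false, ← sq] at r00 r01
  have s01 := sq_nonneg (corr ψ 0 1)
  have hv : 0 < corr ψ 0 2 ^ 2 := by positivity
  have hp0 : 0 < corr ψ 0 1 ^ 2 + corr ψ 0 2 ^ 2 := by positivity
  have hmid := blochMid_eleven hψ hA hp0
  have hg := sq_dot_cross_rows_corr hψ hA
  have hd := (maxEntangled_ineq s01 hv (by linarith [sq_nonneg (corr ψ 0 0)])
    (sq_nonneg (corr ψ 1 0)) (sq_corr_one_zero_le hψ hA)).1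
  have hh : 1 - blochMid ψ 11 ^ 2 = ((corr ψ 0 1 ^ 2 + corr ψ 0 2 ^ 2) ^ 2 -
      (1 - (corr ψ 0 1 ^ 2 + corr ψ 0 2 ^ 2)) * corr ψ 0 1 ^ 2 * corr ψ 1 0 ^ 2) /
      (corr ψ 0 1 ^ 2 + corr ψ 0 2 ^ 2) ^ 2 := by
    rw [hmid]
    field_simp
    linear_combination (-(corr ψ 0 1 ^ 2 * corr ψ 1 0 ^ 2)) * r00
  have hh0 : 0 < 1 - blochMid ψ 11 ^ 2 := by
    rw [hh]
    exact div_pos hd (by positivity)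
  have hdiff : (bloch ψ 11 - blochMid ψ 11) ^ 2 = corr ψ 0 2 ^ 2 *
      (corr ψ 0 1 ^ 2 + corr ψ 0 2 ^ 2 - corr ψ 1 0 ^ 2) /
        (corr ψ 0 1 ^ 2 + corr ψ 0 2 ^ 2) ^ 2 := by
    have : bloch ψ 11 - blochMid ψ 11 =
        corr ψ 0 2 * (corr ψ 0 2 * corr ψ 1 1 - corr ψ 0 1 * corr ψ 1 2) /
          (corr ψ 0 1 ^ 2 + corr ψ 0 2 ^ 2) := by
      rw [hmid]
      change corr ψ 1 1 - _ = _
      field_simp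
      linear_combination corr ψ 0 1 * r01
    rw [this, div_pow, mul_pow, hg]
  rw [infoTerm, chiSq_eq (by linarith), hdiff, hh, div_div_div_cancel_right₀ (by positivity)]

/-- If c₁₁² = 1, the second row contributes its full squared length 1. If c₁₁² ≠ 1 and c₁₃ = 0, then
c₂₂ is determined and the total is 2 - c₂₂². If c₁₃ ≠ 0, then c₂₃ is determined and
`maxEntangled_ineq` decides. -/
theorem postInfo_maxEntangled_le (hψ : IsPureState ψ) (hA : blochA ψ = 0) :
    postInfo ψ ≤ 2 ∧ (postInfo ψ = 2 ↔
      (corr ψ 0 0 ^ 2 = 1 ∨ corr ψ 0 1 ^ 2 = 1 ∨ corr ψ 0 2 ^ 2 = 1) ∨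
      (corr ψ 1 0 ^ 2 = 1 ∨ corr ψ 1 1 ^ 2 = 1 ∨ corr ψ 1 2 ^ 2 = 1)) := by
  have hI := postInfo_maxEntangled hψ hA
  have r00 := hψ.corr_rows hA 0 0
  have r11 := hψ.corr_rows hA 1 1
  have r01 := hψ.corr_rows hA 0 1
  have k0 := hψ.corr_cols hA 0 0
  have k1 := hψ.corr_cols hA 1 1
  have k2 := hψ.corr_cols hA 2 2
  simp only [if_true, zero_ne_one, if_false, ← sq] at r00 r11 r01 k0 k1 k2
  have s00 := sq_nonneg (corr ψ 0 0)
  have s01 := sq_nonneg (corr ψ 0 1)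
  have s02 := sq_nonneg (corr ψ 0 2)
  have s10 := sq_nonneg (corr ψ 1 0)
  have s11 := sq_nonneg (corr ψ 1 1)
  have s12 := sq_nonneg (corr ψ 1 2)
  have s20 := sq_nonneg (corr ψ 2 0)
  have s21 := sq_nonneg (corr ψ 2 1)
  have s22 := sq_nonneg (corr ψ 2 2)
  by_cases hp : corr ψ 0 0 ^ 2 = 1
  · have t11 : infoTerm ψ 11 = corr ψ 1 1 ^ 2 := by
      rw [infoTerm, blochMid_eleven_of_sq_eq_one hψ hA hp, chiSq_zero]; rfl
    have h02 : corr ψ 0 2 = 0 := by nlinarith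
    have t12 : infoTerm ψ 12 = corr ψ 1 2 ^ 2 := by
      rw [infoTerm, blochMid_twelve_of_eq_zero hψ hA h02, chiSq_zero]; rfl
    have : postInfo ψ = 2 := by linarith
    exact ⟨this.le, fun _ => Or.inl (Or.inl hp), fun _ => this⟩
  have hp0 : 0 < corr ψ 0 1 ^ 2 + corr ψ 0 2 ^ 2 := by
    have := lt_of_le_of_ne (show corr ψ 0 0 ^ 2 ≤ 1 by linarith) hp
    linarith
  have hmid := blochMid_eleven hψ hA hp0
  by_cases h02 : corr ψ 0 2 = 0
  · have h01 : corr ψ 0 1 ≠ 0 := by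
      intro h
      simp [h, h02] at hp0
    have t12 : infoTerm ψ 12 = corr ψ 1 2 ^ 2 := by
      rw [infoTerm, blochMid_twelve_of_eq_zero hψ hA h02, chiSq_zero]; rfl
    have t11 : infoTerm ψ 11 = 0 := by
      -- With c₁₃ = 0 and c₁₂ ≠ 0, orthogonality of the rows already solves for c₂₂.
      have : blochMid ψ 11 = bloch ψ 11 := by
        rw [hmid]
        change _ = corr ψ 1 1
        rw [h02] at r01 ⊢
        field_simp
        linear_combination (-corr ψ 0 1) * r01
      rw [infoTerm, this, chiSq_self]
    have hI' : postInfo ψ = 2 - corr ψ 1 1 ^ 2 := by linarith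
    rw [h02] at r01 r00
    refine ⟨by linarith, fun h => ?_, fun h => ?_⟩
    · have h11 : corr ψ 1 1 = 0 := by nlinarith
      rw [h11] at r01
      have : corr ψ 0 0 * corr ψ 1 0 = 0 := by linarith
      rcases mul_eq_zero.1 this with e | e
      · left; right; left
        rw [e] at r00
        linarith
      · right; right; right
        rw [e, h11] at r11
        linarith
    · suffices corr ψ 1 1 ^ 2 = 0 by linarith
      rcases h with (h | h | h) | (h | h | h)
      · exact absurd h hp
      · linarith
      · rw [h02] at h
        norm_num at h
      · linarith
      · exfalso
        have : corr ψ 0 1 ^ 2 = 0 := by linarith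
        exact h01 (by simpa using this)
      · linarith
  · have hv : 0 < corr ψ 0 2 ^ 2 := by positivity
    have hx := sq_corr_one_zero_le hψ hA
    obtain ⟨hd, hle, heq⟩ := maxEntangled_ineq s01 hv (by linarith) s10 hx
    have t11 := infoTerm_eleven hψ hA h02
    have t12 := infoTerm_twelve_of_ne_zero hψ hA h02
    rw [← t11] at hle heq
    refine ⟨by linarith, ?_⟩
    rw [show postInfo ψ = 2 ↔ infoTerm ψ 11 = 1 - corr ψ 1 0 ^ 2 by
      constructor <;> intro h <;> linarith, heq]
    constructor
    · rintro ⟨e1, e2⟩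
      -- The four combinations give c₁₃² = 1, c₂₁² = 1, c₂₂² = 1 and a contradiction with c₁₃ ≠ 0.
      rcases mul_eq_zero.1 e1 with e1 | e1 <;> rcases mul_eq_zero.1 e2 with e2 | e2
      · left; right; right; linarith
      · right; left; linarith
      · right; right; left
        have h01 : corr ψ 0 1 = 0 := by simpa using e2
        have h10 : corr ψ 1 0 = 0 := by simpa using e1
        rw [h01, h10] at r01
        have h12 : corr ψ 1 2 = 0 := by
          simpa [h02] using r01
        rw [h10, h12] at r11
        linarith
      · exfalso; linarith
    · rintro ((h | h | h) | (h | h | h))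
      · exact absurd h hp
      · exfalso; linarith
      · exact ⟨mul_eq_zero_of_left (by linarith) _, mul_eq_zero_of_left (by linarith) _⟩
      · exact ⟨mul_eq_zero_of_left (by linarith) _, mul_eq_zero_of_right _ (by linarith)⟩
      · exact ⟨mul_eq_zero_of_right _ (by linarith), mul_eq_zero_of_left (by linarith) _⟩
      · exfalso; linarith

theorem exists_abs_pauliExp_eq_one_iff (ψ : TwoQubit) :
    (∃ i ∈ ({1, 2} : Set (Fin 4)), ∃ j : Fin 4, j ≠ 0 ∧ |pauliExp ψ i j| = 1) ↔
      (corr ψ 0 0 ^ 2 = 1 ∨ corr ψ 0 1 ^ 2 = 1 ∨ corr ψ 0 2 ^ 2 = 1) ∨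
      (corr ψ 1 0 ^ 2 = 1 ∨ corr ψ 1 1 ^ 2 = 1 ∨ corr ψ 1 2 ^ 2 = 1) := by
  simp [corr, Fin.exists_fin_succ, abs_eq (zero_le_one' ℝ)]

theorem isPureState_bellState (x z : Fin 2) : IsPureState (bellState x z) := by
  rw [isPureState_iff, pauliExp_eq_coordExp]
  fin_cases x <;> fin_cases z <;>
    simp [coordExp, reCoord, imCoord, bellState] <;> ring_nf <;> norm_num

theorem isMaxEntangled_bellState (x z : Fin 2) : IsMaxEntangled (bellState x z) := by
  rw [← localNorm_eq_zero_iff (isPureState_bellState x z), localNorm_eq_zero_iff_blochA]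
  have h4 : √2 ^ 4 = 4 := by
    rw [show 4 = 2 * 2 from rfl, pow_mul, Real.sq_sqrt zero_le_two]
    norm_num
  ext i
  rw [blochA, pauliExp_eq_coordExp]
  fin_cases i <;> fin_cases x <;> fin_cases z <;>
    simp [coordExp, reCoord, imCoord, bellState] <;> field_simp <;> norm_num [h4]

theorem corr_bellState (x z : Fin 2) : corr (bellState x z) 0 0 ^ 2 = 1 := by
  rw [corr, pauliExp_eq_coordExp]
  fin_cases x <;> fin_cases z <;>
    simp [coordExp, reCoord, imCoord, bellState] <;> ring_nf <;> norm_num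

end maxEntangled

end

theorem theorem1 :
    IsGreatest {x : ℝ | ∃ ψ : TwoQubit, IsPureState ψ ∧ postInfo ψ = x} 2 ∧
    (∀ ψ : TwoQubit, IsPureState ψ →
      localNorm ψ ≤ 1 ∧
      (localNorm ψ = 1 ↔ IsProductState ψ) ∧
      (localNorm ψ = 0 ↔ IsMaxEntangled ψ) ∧
      (IsProductState ψ → postInfo ψ = 2) ∧
      (IsMaxEntangled ψ →
        (postInfo ψ = 2 ↔
          ∃ i ∈ ({1, 2} : Set (Fin 4)), ∃ j : Fin 4, j ≠ 0 ∧ |pauliExp ψ i j| = 1)) ∧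
      (0 < localNorm ψ → localNorm ψ < 1 → postInfo ψ < 2)) ∧
    (∀ x z : Fin 2, IsPureState (bellState x z) ∧ IsMaxEntangled (bellState x z) ∧
      postInfo (bellState x z) = 2) := by
  have hbell (x z : Fin 2) : IsPureState (bellState x z) ∧ IsMaxEntangled (bellState x z) ∧
      postInfo (bellState x z) = 2 := by
    have h1 := isPureState_bellState x z
    have h2 := isMaxEntangled_bellState x z
    refine ⟨h1, h2, (postInfo_maxEntangled_le h1 ?_).2.2 (Or.inl (Or.inl (corr_bellState x z)))⟩
    rwa [← localNorm_eq_zero_iff_blochA, localNorm_eq_zero_iff h1]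
  have hlt (ψ : TwoQubit) (hψ : IsPureState ψ) (h0 : 0 < localNorm ψ) (h1 : localNorm ψ < 1) :
      postInfo ψ < 2 := by
    have := localNorm_sq ψ
    exact postInfo_lt_two hψ (by rw [← this]; positivity) (by nlinarith)
  have hprod (ψ : TwoQubit) (hψ : IsPureState ψ) (h : IsProductState ψ) : postInfo ψ = 2 :=
    postInfo_of_dot_eq_one hψ ((blochA_dot_eq_one_iff hψ).2 h)
  refine ⟨⟨⟨bellState 0 0, (hbell 0 0).1, (hbell 0 0).2.2⟩, ?_⟩, fun ψ hψ => ?_, hbell⟩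
  · rintro _ ⟨ψ, hψ, rfl⟩
    rcases (show 0 ≤ localNorm ψ from Real.sqrt_nonneg _).eq_or_lt with h0 | h0
    · exact (postInfo_maxEntangled_le hψ ((localNorm_eq_zero_iff_blochA ψ).1 h0.symm)).1
    rcases (localNorm_le_one hψ).eq_or_lt with h1 | h1
    · exact (hprod ψ hψ ((localNorm_eq_one_iff hψ).1 h1)).le
    · exact (hlt ψ hψ h0 h1).le
  · refine ⟨localNorm_le_one hψ, localNorm_eq_one_iff hψ, localNorm_eq_zero_iff hψ, hprod ψ hψ,
      fun h => ?_, hlt ψ hψ⟩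
    rw [exists_abs_pauliExp_eq_one_iff]
    refine (postInfo_maxEntangled_le hψ ?_).2
    rwa [← localNorm_eq_zero_iff_blochA, localNorm_eq_zero_iff hψ]
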